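/- **Setting.** Let $\Omega\subseteq\mathbb R\times\mathbb R^n$ be a domain (open and connected) whose projection on the time axis is all of $\mathbb R$, and let $f\in C(\Omega,\mathbb R^n)$ be such that solutions of $\dot x=f(t,x)$ are unique. For a $C^1$ function $U$ put $\dot U_f=\partial_tU+\partial_xU\cdot f$, and write $U_t=U(t,\cdot)$, $\mathcal A_t=\{x:(t,x)\in\mathcal A\}$. A *V–W-pair* of the system consists of $V\in C^1(\mathbb R\times\mathbb R^n,\mathbb R)$ such that for every $t$ the set $V_t^{-1}(0)$ is nonempty, $V_t(x)\to\infty$ as $\|x\|\to\infty$, and $\partial_xV_t(x)\neq0$ whenever $V_t(x)>0$; and of $W\in C^1(\Omega,\mathbb R)$ such that $\Omega\cap V^{-1}((0,\infty))\ne\varnothing$ and $\dot W_f>0$ on this set. Consider the following conditions. (A) There are $w_*<w^*$, $c^*>0$, $c_*\in[0,\infty]$ and a connected component $\mathcal W$ of $W^{-1}((w_*,w^*))$ such that $w^*\in W_t(\Omega_t)$ for all $t$, $V^{-1}((-\infty,0])\subseteq\mathcal W$, and $-c_*\dot W_f\le\dot V_f\le c^*\dot W_f$ on $V^{-1}([0,\infty))\cap\mathcal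 W$ (the left inequality is void if $c_*=\infty$). Put $$w_0(t)=\min_{V_t^{-1}(0)}W_t,\quad w^0(t)=\max_{V_t^{-1}(0)}W_t,\quad \omega_0=\inf_tw_0(t),\quad \omega^0=\sup_tw^0(t),\quad \mathcal W^{se}=\partial\mathcal W\cap W^{-1}(w^*).$$ (B) The function $\alpha(t)=\inf\{\dot W_f(t,x):V_t(x)>0,\ x\in\mathcal W_t\}$ satisfies $\int_{-\infty}^0\alpha\,ds=\int_0^\infty\alpha\,ds=\infty$. (C) For all sufficiently large negative $t$, $\mathcal M_t$ is a bounded subset of $\mathcal W_t\cup\mathcal W^{se}_t$ such that $\{t\}\times(\mathcal M_t\cap\mathcal W_t^{se})$ is a retract of $\{(s,x)\in\mathcal W^{se}:s\ge t\}$ but is not a retract of $\{t\}\times\mathcal M_t$. (C′) For all sufficiently large negative $t$, $\mathcal M_t$ is a bounded subset of $\mathcal W_t\cup\mathcal W^{se}_t$ for which there is no topological embedding $g:\mathcal M_t\to\mathcal W^{se}$ with $g(x)=(t,x)$ for all $x\in\mathcal M_t\cap\mathcal W_t^{se}$. For a family $(\mathcal M_t)$ put $$\nu=\liminf_{t\to-\infty}\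 \sup\{V_t(x)-c^*W_t(x):x\in\mathcal M_t,\ V_t(x)>0\}\in[-\infty,\infty].$$ **Theorem.** Let the system have a V–W-pair satisfying (A) and (B), and let a family $(\mathcal M_t)$ satisfy (C) or (C′), with $\nu<\infty$. Suppose that for some real $V^*>c^*w^*+\max\{\nu,-c^*\omega_0\}$ the closure of $V^{-1}([0,V^*))\cap\mathcal W$ lies in $\Omega$. Then the equations $$\int_t^{\tau_+}\alpha\,ds=\omega^0-\omega_0,\qquad \int_{\tau_-}^t\alpha\,ds=\omega^0-\omega_0$$ have, for every $t\in\mathbb R$, roots $\tau_+\ge t$ and $\tau_-\le t$, and there is a solution $x_*(t)$ defined on all of $\mathbb R$ with $\sup_tV(t,x_*(t))<\infty$ such that, for all $t\in\mathbb R$ and all such roots $\tau_\pm=\tau_\pm(t)$, $$V(t,x_*(t))\le\frac{c_*c^*}{c_*+c^*}\Bigl[\sup_{t\le s\le\tau_+}w^0(s)-\inf_{\tau_-\le s\le t}w_0(s)\Bigr]\le\frac{c_*c^*}{c_*+c^*}(\omega^0-\omega_0)$$ (the fraction is read as $c^*$ if $c_*=\infty$), and $\omega_0\le W(t,x_*(t))\le\omega^0$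 for every $t$ with $V(t,x_*(t))\ge0$. In particular, if $\omega_0\le W\le\omega^0$ on $V^{-1}((-\infty,0])$, then $\omega_0\le W(t,x_*(t))\le\omega^0$ for all $t\in\mathbb R$. -/

import Mathlib

open Set Filter Topology MeasureTheory
open scoped ENNReal

noncomputable section

namespace VWPair

/-- The phase space `ℝⁿ` with the Euclidean norm; the extended phase space is `ℝ × Phase n`. -/
abbrev Phase (n : ℕ) : Type := EuclideanSpace ℝ (Fin n)

/-- `x` solves `ẋ = f(t,x)` on the set (interval) `I`, with graph in `Ω`. -/
def IsSolutionOn {n : ℕ} (Ω : Set (ℝ × Phase n)) (f : ℝ × Phase n → Phase n)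
    (x : ℝ → Phase n) (I : Set ℝ) : Prop :=
  ∀ t ∈ I, (t, x t) ∈ Ω ∧ HasDerivWithinAt x (f (t, x t)) I t

/-- Uniqueness property: two solutions on an interval which agree at one of its points coincide. -/
def HasUniqueness {n : ℕ} (Ω : Set (ℝ × Phase n)) (f : ℝ × Phase n → Phase n) : Prop :=
  ∀ (I : Set ℝ) (x y : ℝ → Phase n), I.OrdConnected →
    IsSolutionOn Ω f x I → IsSolutionOn Ω f y I →
    ∀ t₀ ∈ I, x t₀ = y t₀ → EqOn x y I

/-- Standing assumptions on the system: `Ω` is a domain whose projection on the time axis is the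
whole axis, `f` is continuous on `Ω`, and solutions are unique. -/
structure IsSystem {n : ℕ} (Ω : Set (ℝ × Phase n)) (f : ℝ × Phase n → Phase n) : Prop where
  isOpen : IsOpen Ω
  isConnected : IsConnected Ω
  covers_time : ∀ t : ℝ, ∃ x : Phase n, (t, x) ∈ Ω
  continuousOn : ContinuousOn f Ω
  uniqueness : HasUniqueness Ω f

/-- Derivative of `U` by virtue of the system, `∂U/∂t + ∂U/∂x · f`. -/
def flowDeriv {n : ℕ} (f : ℝ × Phase n → Phase n) (U : ℝ × Phase n → ℝ) (p : ℝ × Phase n) : ℝ :=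
  fderiv ℝ U p (1, f p)

structure IsSpatiallyCoercive {n : ℕ} (V : ℝ × Phase n → ℝ) : Prop where
  continuous : Continuous V
  zero_level_nonempty : ∀ t : ℝ, ∃ x : Phase n, V (t, x) = 0
  coercive : ∀ t : ℝ, Tendsto (fun x : Phase n => V (t, x)) (Bornology.cobounded (Phase n)) atTop

structure IsRegularSpatiallyCoercive {n : ℕ} (V : ℝ × Phase n → ℝ) : Prop
    extends IsSpatiallyCoercive V where
  contDiff : ContDiff ℝ 1 V
  gradient_ne_zero : ∀ (t : ℝ) (x : Phase n), 0 < V (t, x) →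
    fderiv ℝ (fun y : Phase n => V (t, y)) x ≠ 0

/-- `W` is a guiding function concordant with `V`. -/
structure IsGuidingFunction {n : ℕ} (Ω : Set (ℝ × Phase n)) (f : ℝ × Phase n → Phase n)
    (V W : ℝ × Phase n → ℝ) : Prop where
  contDiffOn : ContDiffOn ℝ 1 W Ω
  nonempty : (Ω ∩ {p | 0 < V p}).Nonempty
  flowDeriv_pos : ∀ p ∈ Ω, 0 < V p → 0 < flowDeriv f W p

structure IsVWPair {n : ℕ} (Ω : Set (ℝ × Phase n)) (f : ℝ × Phase n → Phase n)
    (V W : ℝ × Phase n → ℝ) : Prop where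
  regular : IsRegularSpatiallyCoercive V
  guiding : IsGuidingFunction Ω f V W

/-- Condition (A) with the data `w_* = wLow`, `w^* = wUp`, `c_* = cLow ∈ [0,∞]`, `c^* = cUp`, and
the component `𝒲` of `W⁻¹((w_*, w^*))`. For `c_* = ∞` the lower inequality imposes nothing. -/
structure ConditionA {n : ℕ} (Ω : Set (ℝ × Phase n)) (f : ℝ × Phase n → Phase n)
    (V W : ℝ × Phase n → ℝ) (wLow wUp : ℝ) (cLow : ℝ≥0∞) (cUp : ℝ) (𝒲 : Set (ℝ × Phase n)) :
    Prop where
  w_lt : wLow < wUp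
  cUp_pos : 0 < cUp
  component : ∃ p ∈ {q ∈ Ω | W q ∈ Ioo wLow wUp},
    𝒲 = connectedComponentIn {q ∈ Ω | W q ∈ Ioo wLow wUp} p
  wUp_in_range : ∀ t : ℝ, ∃ x : Phase n, (t, x) ∈ Ω ∧ W (t, x) = wUp
  sublevel_subset : {p | V p ≤ 0} ⊆ 𝒲
  lower_ineq : ∀ p ∈ 𝒲, 0 ≤ V p → cLow ≠ ⊤ → -cLow.toReal * flowDeriv f W p ≤ flowDeriv f V p
  upper_ineq : ∀ p ∈ 𝒲, 0 ≤ V p → flowDeriv f V p ≤ cUp * flowDeriv f W p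

/-- `w_0(t)`, the minimum of `W_t` on the compact nonempty set `V_t⁻¹(0)`. -/
def wMin {n : ℕ} (V W : ℝ × Phase n → ℝ) (t : ℝ) : ℝ :=
  sInf ((fun x : Phase n => W (t, x)) '' {x | V (t, x) = 0})

/-- `w^0(t)`, the maximum of `W_t` on the compact nonempty set `V_t⁻¹(0)`. -/
def wMax {n : ℕ} (V W : ℝ × Phase n → ℝ) (t : ℝ) : ℝ :=
  sSup ((fun x : Phase n => W (t, x)) '' {x | V (t, x) = 0})

/-- `ω_0`, the infimum of `w_0` over the time axis. -/
def omegaMin {n : ℕ} (V W : ℝ × Phase n → ℝ) : ℝ := ⨅ t : ℝ, wMin V W t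

/-- `ω^0`, the supremum of `w^0` over the time axis. -/
def omegaMax {n : ℕ} (V W : ℝ × Phase n → ℝ) : ℝ := ⨆ t : ℝ, wMax V W t

/-- The set `𝒲^{se} = ∂𝒲 ∩ W⁻¹(w^*)` of strict exit points. -/
def exitSet {n : ℕ} (Ω : Set (ℝ × Phase n)) (W : ℝ × Phase n → ℝ) (wUp : ℝ)
    (𝒲 : Set (ℝ × Phase n)) : Set (ℝ × Phase n) :=
  frontier 𝒲 ∩ {p ∈ Ω | W p = wUp}

/-- `α(t) = inf {Ẇ_f(t,x) : V(t,x) > 0, (t,x) ∈ 𝒲}`. Under condition (A) this is the infimum of a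
nonempty set of positive numbers, and `α` is upper semicontinuous, hence locally integrable. -/
def alpha {n : ℕ} (f : ℝ × Phase n → Phase n) (V W : ℝ × Phase n → ℝ)
    (𝒲 : Set (ℝ × Phase n)) (t : ℝ) : ℝ :=
  sInf ((fun x : Phase n => flowDeriv f W (t, x)) '' {x | 0 < V (t, x) ∧ (t, x) ∈ 𝒲})

/-- Condition (B): the integrals of `α` over both half-axes are infinite. -/
def ConditionB {n : ℕ} (f : ℝ × Phase n → Phase n) (V W : ℝ × Phase n → ℝ)
    (𝒲 : Set (ℝ × Phase n)) : Prop :=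
  Tendsto (fun T : ℝ => ∫ s in T..0, alpha f V W 𝒲 s) atBot atTop ∧
  Tendsto (fun T : ℝ => ∫ s in (0 : ℝ)..T, alpha f V W 𝒲 s) atTop atTop

/-- `A` is a retract of `X`. -/
def IsRetractOf {α : Type*} [TopologicalSpace α] (A X : Set α) : Prop :=
  A ⊆ X ∧ ∃ r : α → α, ContinuousOn r X ∧ MapsTo r X A ∧ ∀ a ∈ A, r a = a

/-- The set `{t} × (M ∩ 𝒲_t^{se})`, where `S` stands for `𝒲^{se}`. -/
def exitPart {n : ℕ} (S : Set (ℝ × Phase n)) (t : ℝ) (M : Set (Phase n)) : Set (ℝ × Phase n) :=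
  {p ∈ S | p.1 = t ∧ p.2 ∈ M}

/-- `M` is a bounded subset of `𝒲_t ∪ 𝒲_t^{se}`, where `S` stands for `𝒲^{se}`. -/
def IsAdmissible {n : ℕ} (𝒲 S : Set (ℝ × Phase n)) (t : ℝ) (M : Set (Phase n)) : Prop :=
  Bornology.IsBounded M ∧ ∀ x ∈ M, (t, x) ∈ 𝒲 ∪ S

/-- The Ważewski condition (C) for the family `M`, where `S` stands for `𝒲^{se}`. -/
def ConditionC {n : ℕ} (𝒲 S : Set (ℝ × Phase n)) (M : ℝ → Set (Phase n)) : Prop :=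
  ∀ᶠ t in atBot, IsAdmissible 𝒲 S t (M t) ∧
    IsRetractOf (exitPart S t (M t)) {p ∈ S | t ≤ p.1} ∧
    ¬ IsRetractOf (exitPart S t (M t)) ({t} ×ˢ M t)

/-- The Ważewski condition (C′) for the family `M`, where `S` stands for `𝒲^{se}`: there is no
topological embedding of `M t` into `S` which sends each `x` with `(t, x) ∈ S` to `(t, x)`. -/
def ConditionC' {n : ℕ} (𝒲 S : Set (ℝ × Phase n)) (M : ℝ → Set (Phase n)) : Prop :=
  ∀ᶠ t in atBot, IsAdmissible 𝒲 S t (M t) ∧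
    ¬ ∃ g : M t → ℝ × Phase n, IsEmbedding g ∧ (∀ x, g x ∈ S) ∧
      ∀ x : M t, (t, (x : Phase n)) ∈ S → g x = (t, (x : Phase n))

/-- `ν = liminf_{t → -∞} sup {V_t(x) - c^* W_t(x) : x ∈ M_t, V_t(x) > 0}` in `[-∞, ∞]`. -/
def nu {n : ℕ} (V W : ℝ × Phase n → ℝ) (cUp : ℝ) (M : ℝ → Set (Phase n)) : EReal :=
  liminf (fun t : ℝ => ⨆ x ∈ {x | x ∈ M t ∧ 0 < V (t, x)},
    ((V (t, x) - cUp * W (t, x) : ℝ) : EReal)) atBot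

/-- `c_* c^* / (c_* + c^*)`, equal to `c^*` for `c_* = ∞`. -/
def coeff (cLow : ℝ≥0∞) (cUp : ℝ) : ℝ :=
  if cLow = ⊤ then cUp else cLow.toReal * cUp / (cLow.toReal + cUp)

/-- `x` is a V-bounded solution defined on the whole time axis. -/
def IsGlobalVBoundedSolution {n : ℕ} (Ω : Set (ℝ × Phase n)) (f : ℝ × Phase n → Phase n)
    (V : ℝ × Phase n → ℝ) (x : ℝ → Phase n) : Prop :=
  IsSolutionOn Ω f x univ ∧ BddAbove (range fun t : ℝ => V (t, x t))

/-- `τ` is a root `τ_+ ≥ t` of `∫_t^τ α = ω^0 - ω_0`. -/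
def IsTauPlus {n : ℕ} (f : ℝ × Phase n → Phase n) (V W : ℝ × Phase n → ℝ)
    (𝒲 : Set (ℝ × Phase n)) (t τ : ℝ) : Prop :=
  t ≤ τ ∧ ∫ s in t..τ, alpha f V W 𝒲 s = omegaMax V W - omegaMin V W

/-- `τ` is a root `τ_- ≤ t` of `∫_τ^t α = ω^0 - ω_0`. -/
def IsTauMinus {n : ℕ} (f : ℝ × Phase n → Phase n) (V W : ℝ × Phase n → ℝ)
    (𝒲 : Set (ℝ × Phase n)) (t τ : ℝ) : Prop :=
  τ ≤ t ∧ ∫ s in τ..t, alpha f V W 𝒲 s = omegaMax V W - omegaMin V W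

end VWPair

end

namespace VWPair

/-! Where V > 0, W strictly increases along solutions, and inside 𝒲 the function V - c^*W does not
increase. So a solution in 𝒲 whose starting point has V ≤ 0 or V - c^*W ≤ r satisfies V ≤ c^*w^* + r
< V^* as long as it stays there (`IsVWPair.apply_le`; r also dominates -c^*ω_0). It therefore runs
in a compact part of Ω over bounded times and can leave 𝒲 only by crossing the level W = w^* upwards
(`exists_staying_or_exiting`).

Such exits are strict, so the exit point depends continuously on the starting point, and conversely.
If every solution starting in M_t left 𝒲, the exit map would yield the retraction that (C) forbids
or the embedding that (C′) forbids. Hence for each k some solution stays in 𝒲 on [-k,k]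
(`exists_staying_solution`), and a limit of these is a global solution in 𝒲 with V bounded
(`exists_global_solution`).

For the sharp bound, (B) and the boundedness of W on 𝒲 force every excursion into V > 0 to begin and
end on V = 0 (`exists_excursion`). The two inequalities of (A), integrated from each end of an
excursion, bound V by the increase of W between the ends (`IsVWPair.apply_le_coeff_mul`), and the
integral of α limits how far from t the ends can be (`excursion_subset`).

Compactness rests on the sublevel sets of V_t being bounded locally uniformly in t. Coercivity at
each single t does not give this; the absence of critical points in V_t > 0 does, by a mountain pass
argument. -/

variable {n : ℕ}

/-! ### Existence and continuous dependence for continuous fields -/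

/-- A compactly supported continuous map is a uniform limit of Lipschitz maps. -/
theorem exists_lipschitzWith_near {G E : Type*} [NormedAddCommGroup G] [NormedSpace ℝ G]
    [FiniteDimensional ℝ G] [NormedAddCommGroup E] [NormedSpace ℝ E] [CompleteSpace E]
    {F : G → E} (hF : Continuous F)
    (hFc : HasCompactSupport F) {ε : ℝ} (hε : 0 < ε) :
    ∃ (K : NNReal) (g : G → E), LipschitzWith K g ∧ ∀ p, ‖g p - F p‖ ≤ ε := by
  borelize G
  let μ : Measure G := Measure.addHaar
  obtain ⟨δ, hδ, hFδ⟩ :=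
    Metric.uniformContinuous_iff.1 (hFc.uniformContinuous_of_continuous hF) ε hε
  let φ : ContDiffBump (0 : G) := ⟨δ / 2, δ, by positivity, by linarith⟩
  -- Mollification: the bump averages F over a δ-ball, on which F varies by less than ε; smoothness
  -- together with compact support gives the Lipschitz constant.
  let g : G → E := MeasureTheory.convolution (φ.normed μ) F (ContinuousLinearMap.lsmul ℝ ℝ) μ
  have hc : HasCompactSupport g := φ.hasCompactSupport_normed.convolution _ hFc
  have hs : ContDiff ℝ 1 g :=
    φ.hasCompactSupport_normed.contDiff_convolution_left (n := 1) _ φ.contDiff_normed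
      hF.locallyIntegrable
  obtain ⟨K, hK⟩ := hs.lipschitzWith_of_hasCompactSupport hc one_ne_zero
  refine ⟨K, g, hK, fun p => ?_⟩
  rw [← dist_eq_norm]
  exact φ.dist_normed_convolution_le hF.aestronglyMeasurable fun q hq => (hFδ hq).le

/-- The global bound on the field allows a Picard–Lindelöf ball so large that the solution cannot
leave it before the ends of the interval. -/
theorem exists_solution_of_lipschitzWith {g : ℝ × Phase n → Phase n} {K : NNReal}
    (hg : LipschitzWith K g) {B : ℝ} (hB : ∀ p, ‖g p‖ ≤ B) {a b t₀ : ℝ} (ht₀ : t₀ ∈ Icc a b)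
    (x₀ : Phase n) : ∃ y : ℝ → Phase n, y t₀ = x₀ ∧ IsSolutionOn univ g y (Icc a b) := by
  have hB0 : 0 ≤ B := (norm_nonneg _).trans (hB 0)
  have hm : 0 ≤ B * max (b - t₀) (t₀ - a) :=
    mul_nonneg hB0 (le_max_of_le_left (sub_nonneg.2 ht₀.2))
  have hPL : IsPicardLindelof (fun t x => g (t, x)) (⟨t₀, ht₀⟩ : Icc a b) x₀
      ⟨B * max (b - t₀) (t₀ - a), hm⟩ 0 ⟨B, hB0⟩ K :=
    { lipschitzOnWith := fun t _ => (LipschitzWith.of_dist_le_mul fun x y => by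
        simpa [Prod.dist_eq] using hg.dist_le_mul (t, x) (t, y)).lipschitzOnWith
      continuousOn := fun x _ => (hg.continuous.comp (by fun_prop)).continuousOn
      norm_le := fun t _ x _ => hB _
      mul_max_le := by rw [NNReal.coe_zero, sub_zero]; exact le_rfl }
  obtain ⟨y, hy0, hy⟩ := hPL.exists_eq_forall_mem_Icc_hasDerivWithinAt₀
  exact ⟨y, hy0, fun t ht => ⟨mem_univ _, hy t ht⟩⟩

/-- A curve whose velocity is bounded by `L` is `L`-Lipschitz. -/
theorem IsSolutionOn.norm_sub_le {Ω : Set (ℝ × Phase n)} {g : ℝ × Phase n → Phase n}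
    {x : ℝ → Phase n} {I : Set ℝ} (hI : I.OrdConnected) (hx : IsSolutionOn Ω g x I) {L : ℝ}
    (hL : ∀ t ∈ I, ‖g (t, x t)‖ ≤ L) {s t : ℝ} (hs : s ∈ I) (ht : t ∈ I) :
    ‖x t - x s‖ ≤ L * |t - s| :=
  hI.convex.norm_image_sub_le_of_norm_hasDerivWithin_le (fun r hr => (hx r hr).2) hL hs ht

theorem IsSolutionOn.mono {Ω : Set (ℝ × Phase n)} {g : ℝ × Phase n → Phase n}
    {x : ℝ → Phase n} {I J : Set ℝ} (hx : IsSolutionOn Ω g x I) (hJ : J ⊆ I) :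
    IsSolutionOn Ω g x J :=
  fun t ht => ⟨(hx t (hJ ht)).1, (hx t (hJ ht)).2.mono hJ⟩

theorem IsSolutionOn.continuousOn {Ω : Set (ℝ × Phase n)} {g : ℝ × Phase n → Phase n}
    {x : ℝ → Phase n} {I : Set ℝ} (hx : IsSolutionOn Ω g x I) : ContinuousOn x I :=
  fun t ht => (hx t ht).2.continuousWithinAt

theorem IsSolutionOn.congr_field {Ω Ω' : Set (ℝ × Phase n)} {g g' : ℝ × Phase n → Phase n}
    {x : ℝ → Phase n} {I : Set ℝ} (hx : IsSolutionOn Ω g x I)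
    (h : ∀ t ∈ I, (t, x t) ∈ Ω' ∧ g (t, x t) = g' (t, x t)) : IsSolutionOn Ω' g' x I :=
  fun t ht => ⟨(h t ht).1, (h t ht).2 ▸ (hx t ht).2⟩

/-- A pointwise limit of solutions of `ẋ = gₖ(t,x)` has the derivative given by the limit field,
provided that the velocities are uniformly bounded. -/
theorem hasDerivWithinAt_of_tendsto {ι : Type*} {l : Filter ι} [NeBot l]
    {g : ι → ℝ × Phase n → Phase n} {x : ι → ℝ → Phase n} {y : ℝ → Phase n} {v : Phase n}
    {I : Set ℝ} (hI : I.OrdConnected) {s L : ℝ} (hs : s ∈ I)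
    (hlim : ∀ t ∈ I, Tendsto (fun k => x k t) l (𝓝 (y t)))
    (hsol : ∀ᶠ k in l, IsSolutionOn univ (g k) (x k) I ∧ ∀ t ∈ I, ‖g k (t, x k t)‖ ≤ L)
    (hg : Tendsto (fun q : ι × (ℝ × Phase n) => g q.1 q.2) (l ×ˢ 𝓝 (s, y s)) (𝓝 v)) :
    HasDerivWithinAt y v I s := by
  rw [hasDerivWithinAt_iff_isLittleO, Asymptotics.isLittleO_iff]
  intro c hc
  have h1 := (Metric.tendsto_nhds.1 hg c hc)
  rw [eventually_prod_iff] at h1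
  obtain ⟨pa, hpa, pb, hpb, hab⟩ := h1
  obtain ⟨δ, hδ, hδb⟩ := Metric.eventually_nhds_iff.1 hpb
  have hL : 0 ≤ L := by
    obtain ⟨k, hk⟩ := hsol.exists
    exact (norm_nonneg _).trans (hk.2 s hs)
  -- For times this close to s a speed of at most L moves a curve by less than δ / 2; the other half
  -- of δ is left for the distance from `x k s` to `y s`.
  have hη : 0 < δ / (2 * (L + 1)) := by positivity
  filter_upwards [inter_mem_nhdsWithin I (Metric.ball_mem_nhds s hη)] with t ht
  obtain ⟨htI, hts⟩ := ht
  rw [Metric.mem_ball, Real.dist_eq] at hts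
  have hts' : (L + 1) * |t - s| < δ / 2 := by
    rw [lt_div_iff₀ (by positivity)] at hts
    linarith
  have hlim' : Tendsto (fun k => ‖x k t - x k s - (t - s) • v‖) l
      (𝓝 ‖y t - y s - (t - s) • v‖) :=
    (((hlim t htI).sub (hlim s hs)).sub_const _).norm
  refine le_of_tendsto hlim' ?_
  have hnear : ∀ᶠ k in l, dist (x k s) (y s) < δ / 2 :=
    Metric.tendsto_nhds.1 (hlim s hs) _ (by positivity)
  filter_upwards [hsol, hnear, hpa] with k hk hks hpk
  have hsub : uIcc s t ⊆ I := hI.uIcc_subset hs htI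
  have key : ∀ r ∈ uIcc s t, ‖g k (r, x k r) - v‖ ≤ c := by
    intro r hr
    have hrs : |r - s| ≤ |t - s| := abs_sub_left_of_mem_uIcc hr
    have hd : dist (r, x k r) (s, y s) < δ := by
      have h2 := hk.1.norm_sub_le hI hk.2 hs (hsub hr)
      have h3 : L * |r - s| ≤ L * |t - s| := by gcongr
      have h4 : dist (x k r) (y s) ≤ ‖x k r - x k s‖ + dist (x k s) (y s) := by
        rw [← dist_eq_norm]; exact dist_triangle _ _ _
      rw [Prod.dist_eq, max_lt_iff]
      constructor
      · rw [Real.dist_eq]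
        nlinarith [abs_nonneg (t - s), mul_nonneg hL (abs_nonneg (t - s))]
      · simp only
        nlinarith [abs_nonneg (t - s)]
    have := hab hpk (hδb hd)
    rw [dist_eq_norm] at this
    exact this.le
  have := (convex_uIcc s t).norm_image_sub_le_of_norm_hasDerivWithin_le
    (f := fun r => x k r - (r - s) • v) (f' := fun r => g k (r, x k r) - v)
    (fun r hr => by
      have := ((hk.1 r (hsub hr)).2.mono hsub).sub
        ((((hasDerivAt_id r).sub_const s).smul_const v).hasDerivWithinAt (s := uIcc s t))
      rw [one_smul] at this
      exact this)
    key left_mem_uIcc right_mem_uIcc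
  simp only [sub_self, zero_smul, sub_zero] at this
  rw [Real.norm_eq_abs] at this ⊢
  rwa [sub_right_comm]

/-- **Peano's theorem** for a compactly supported continuous field. -/
theorem exists_solution_of_hasCompactSupport {F : ℝ × Phase n → Phase n} (hF : Continuous F)
    (hFc : HasCompactSupport F) {a b t₀ : ℝ} (ht₀ : t₀ ∈ Icc a b) (x₀ : Phase n) :
    ∃ y : ℝ → Phase n, y t₀ = x₀ ∧ IsSolutionOn univ F y (Icc a b) := by
  obtain ⟨B, hB⟩ := hFc.exists_bound_of_continuous hF
  have happ : ∀ k : ℕ, ∃ (g : ℝ × Phase n → Phase n) (x : ℝ → Phase n),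
      (∀ p, ‖g p - F p‖ ≤ 1 / ((k : ℝ) + 1)) ∧ x t₀ = x₀ ∧ IsSolutionOn univ g x (Icc a b) ∧
      ∀ p, ‖g p‖ ≤ B + 1 := by
    intro k
    obtain ⟨K, g, hg, hgF⟩ := exists_lipschitzWith_near hF hFc (ε := 1 / ((k : ℝ) + 1))
      (by positivity)
    have hgB : ∀ p, ‖g p‖ ≤ B + 1 := fun p => by
      have h1 : 1 / ((k : ℝ) + 1) ≤ 1 := by
        rw [div_le_one (by positivity)]; linarith [Nat.cast_nonneg (α := ℝ) k]
      have h2 : ‖g p‖ ≤ ‖g p - F p‖ + ‖F p‖ := by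
        simpa using norm_add_le (g p - F p) (F p)
      linarith [hB p, hgF p]
    obtain ⟨x, hx0, hx⟩ := exists_solution_of_lipschitzWith hg hgB ht₀ x₀
    exact ⟨g, x, hgF, hx0, hx, hgB⟩
  choose g x hgF hx0 hx hgB using happ
  -- The ultrafilter replaces Arzelà–Ascoli: limits exist at each time by compactness of balls, and
  -- pointwise convergence with bounded speed suffices to pass to the limit in the equation.
  let l : Ultrafilter ℕ := Ultrafilter.of atTop
  have hl : (l : Filter ℕ) ≤ atTop := Ultrafilter.of_le _
  have hbdd : ∀ t ∈ Icc a b, ∃ z, Tendsto (fun k => x k t) l (𝓝 z) := by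
    intro t ht
    have hmem : ∀ k, x k t ∈ Metric.closedBall x₀ ((B + 1) * |t - t₀|) := fun k => by
      have := (hx k).norm_sub_le ordConnected_Icc (fun t _ => hgB k _) ht₀ ht
      rwa [hx0, ← dist_eq_norm] at this
    obtain ⟨z, -, hz⟩ := (isCompact_closedBall x₀ ((B + 1) * |t - t₀|)).ultrafilter_le_nhds
      (l.map fun k => x k t) (by
        rw [le_principal_iff, Ultrafilter.mem_coe, Ultrafilter.mem_map,
          eq_univ_of_forall (s := _ ⁻¹' _) hmem]
        exact univ_mem)
    exact ⟨z, hz⟩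
  choose! y hy using hbdd
  refine ⟨y, tendsto_nhds_unique (hy t₀ ht₀) (by simp [hx0]), fun s hs => ⟨mem_univ _, ?_⟩⟩
  refine hasDerivWithinAt_of_tendsto ordConnected_Icc hs hy (L := B + 1) (g := g)
    (Eventually.of_forall fun k => ⟨hx k, fun t _ => hgB k _⟩) ?_
  have h1 : Tendsto (fun q : ℕ × (ℝ × Phase n) => g q.1 q.2 - F q.2) ((l : Filter ℕ) ×ˢ 𝓝 (s, y s))
      (𝓝 0) :=
    squeeze_zero_norm (fun q => hgF q.1 q.2)
      ((tendsto_one_div_add_atTop_nhds_zero_nat.mono_left hl).comp tendsto_fst)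
  have h2 : Tendsto (fun q : ℕ × (ℝ × Phase n) => F q.2) ((l : Filter ℕ) ×ˢ 𝓝 (s, y s))
      (𝓝 (F (s, y s))) := (hF.tendsto _).comp tendsto_snd
  simpa using h1.add h2

/-- A continuous field can be modified far from a compact set so as to have compact support. -/
theorem exists_field_eq_near {Ω : Set (ℝ × Phase n)} (hΩ : IsOpen Ω) {f : ℝ × Phase n → Phase n}
    (hf : ContinuousOn f Ω) {C : Set (ℝ × Phase n)} (hC : IsCompact C) (hCΩ : C ⊆ Ω) :
    ∃ (F : ℝ × Phase n → Phase n) (N : Set (ℝ × Phase n)), Continuous F ∧ HasCompactSupport F ∧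
      IsOpen N ∧ C ⊆ N ∧ N ⊆ Ω ∧ EqOn F f N := by
  obtain ⟨K₁, hK₁, hCK₁, hK₁Ω⟩ := exists_compact_between hC hΩ hCΩ
  obtain ⟨K₂, hK₂, hK₁K₂, hK₂Ω⟩ := exists_compact_between hK₁ hΩ hK₁Ω
  obtain ⟨χ, hχ1, hχ0, -, -⟩ := exists_continuous_one_zero_of_isCompact hK₁
    (isOpen_interior (s := K₂)).isClosed_compl (disjoint_compl_right_iff_subset.2 hK₁K₂)
  refine ⟨fun p => χ p • f p, interior K₁, ?_, ?_, isOpen_interior, hCK₁,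
    interior_subset.trans hK₁Ω, fun p hp => by simp [hχ1 (interior_subset hp)]⟩
  · rw [continuous_iff_continuousAt]
    intro p
    by_cases hp : p ∈ Ω
    · exact χ.continuous.continuousAt.smul (hf.continuousAt (hΩ.mem_nhds hp))
    · have hp2 : p ∈ K₂ᶜ := fun h => hp (hK₂Ω h)
      have : (fun q => χ q • f q) =ᶠ[𝓝 p] fun _ => 0 := by
        filter_upwards [hK₂.isClosed.isOpen_compl.mem_nhds hp2] with q hq
        rw [hχ0 fun h => hq (interior_subset h)]
        simp
      exact continuousAt_const.congr this.symm
  · refine HasCompactSupport.intro hK₂ fun p hp => ?_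
    rw [hχ0 fun h => hp (interior_subset h)]
    simp

theorem IsSolutionOn.isCompact_graph {Ω : Set (ℝ × Phase n)} {g : ℝ × Phase n → Phase n}
    {x : ℝ → Phase n} {a b : ℝ} (hx : IsSolutionOn Ω g x (Icc a b)) :
    IsCompact ((fun t => (t, x t)) '' Icc a b) :=
  isCompact_Icc.image_of_continuousOn (continuousOn_id.prodMk hx.continuousOn)

/-- Uniqueness persists for a field which agrees with `f` near the graph of one of the solutions. -/
theorem eqOn_of_field_eq_near {Ω : Set (ℝ × Phase n)} {f F : ℝ × Phase n → Phase n}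
    (huniq : HasUniqueness Ω f) {N : Set (ℝ × Phase n)} (hN : IsOpen N) (hNΩ : N ⊆ Ω)
    (hFf : EqOn F f N) {x y : ℝ → Phase n} {I : Set ℝ} (hI : I.OrdConnected)
    (hx : IsSolutionOn Ω f x I) (hxN : ∀ t ∈ I, (t, x t) ∈ N) (hy : IsSolutionOn univ F y I)
    {t₀ : ℝ} (ht₀ : t₀ ∈ I) (h0 : x t₀ = y t₀) : EqOn x y I := by
  -- Agreement of x and y is locally constant on I: next to a common point y also lies in N, so both
  -- solve the original equation there; disagreement is open by continuity.
  have hloc : ∀ t ∈ I, ∀ᶠ s in 𝓝[I] t, (x t = y t ↔ x s = y s) := by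
    intro t ht
    by_cases hxy : x t = y t
    · have hyN : ∀ᶠ s in 𝓝[I] t, (s, y s) ∈ N :=
        (continuousWithinAt_id.prodMk (hy.continuousOn t ht)).eventually
          (hN.mem_nhds (by simpa [← hxy] using hxN t ht))
      rw [eventually_nhdsWithin_iff, Metric.eventually_nhds_iff_ball] at hyN
      obtain ⟨ε, hε, hball⟩ := hyN
      filter_upwards [inter_mem_nhdsWithin I (Metric.ball_mem_nhds t hε)] with s hs
      have hJ : (I ∩ Metric.ball t ε).OrdConnected := by
        rw [Real.ball_eq_Ioo]; exact hI.inter ordConnected_Ioo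
      refine iff_of_true hxy (huniq _ x y hJ (hx.mono inter_subset_left)
        ((hy.mono inter_subset_left).congr_field fun r hr => ?_) t
        ⟨ht, Metric.mem_ball_self hε⟩ hxy hs)
      exact ⟨hNΩ (hball r hr.2 hr.1), hFf (hball r hr.2 hr.1)⟩
    · filter_upwards [((hx.continuousOn t ht).sub (hy.continuousOn t ht)).eventually_ne
        (sub_ne_zero.2 hxy)] with s hs using iff_of_false hxy (sub_ne_zero.1 hs)
  intro t ht
  exact (hI.isPreconnected.induction₂ (fun t s => x t = y t ↔ x s = y s) hloc
    (fun _ _ _ _ _ _ h h' => h.trans h') (fun _ _ _ _ h => h.symm) ht₀ ht).1 h0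

/-- Continuous dependence of solutions on the initial data. -/
theorem exists_continuous_dependence {Ω : Set (ℝ × Phase n)} {f : ℝ × Phase n → Phase n}
    (hsys : IsSystem Ω f) {a b t₀ : ℝ} (ht₀ : t₀ ∈ Icc a b) {x : ℝ → Phase n}
    (hx : IsSolutionOn Ω f x (Icc a b)) :
    ∃ Y : ℝ × Phase n → ℝ → Phase n,
      (∀ᶠ p in 𝓝 (t₀, x t₀), p.1 ∈ Icc a b → Y p p.1 = p.2 ∧ IsSolutionOn Ω f (Y p) (Icc a b)) ∧
      ∀ U : Set (ℝ × Phase n), IsOpen U → ∀ J ⊆ Icc a b, IsCompact J → (∀ t ∈ J, (t, x t) ∈ U) →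
        ∀ᶠ p in 𝓝 (t₀, x t₀), p.1 ∈ Icc a b → ∀ t ∈ J, (t, Y p t) ∈ U := by
  obtain ⟨F, N, hF, hFc, hN, hxN, hNΩ, hFf⟩ := exists_field_eq_near hsys.isOpen hsys.continuousOn
    hx.isCompact_graph (image_subset_iff.2 fun t ht => (hx t ht).1)
  obtain ⟨B, hB⟩ := hFc.exists_bound_of_continuous hF
  have hxN' : ∀ t ∈ Icc a b, (t, x t) ∈ N := fun t ht => hxN (mem_image_of_mem _ ht)
  choose! Y hY0 hY using fun (p : ℝ × Phase n) (hp : p.1 ∈ Icc a b) =>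
    exists_solution_of_hasCompactSupport hF hFc hp p.2
  have hlip : ∀ p : ℝ × Phase n, p.1 ∈ Icc a b → ∀ s ∈ Icc a b, ∀ t ∈ Icc a b,
      ‖Y p t - Y p s‖ ≤ B * |t - s| := fun p hp s hs t ht =>
    (hY p hp).norm_sub_le ordConnected_Icc (fun t _ => hB _) hs ht
  let S : Set (ℝ × Phase n) := {p | p.1 ∈ Icc a b}
  have hinit : ∀ l : Filter (ℝ × Phase n), l ≤ 𝓝[S] (t₀, x t₀) →
      Tendsto (fun p => Y p t₀) l (𝓝 (x t₀)) := by
    intro l hl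
    have h1 : Tendsto (fun p : ℝ × Phase n => p.2) l (𝓝 (x t₀)) :=
      (continuous_snd.tendsto (t₀, x t₀)).mono_left (hl.trans nhdsWithin_le_nhds)
    have h2 : Tendsto (fun p : ℝ × Phase n => B * |t₀ - p.1|) l (𝓝 0) := by
      have : Tendsto (fun p : ℝ × Phase n => B * |t₀ - p.1|) (𝓝 (t₀, x t₀)) (𝓝 (B * |t₀ - t₀|)) :=
        Continuous.tendsto (f := fun p : ℝ × Phase n => B * |t₀ - p.1|) (by fun_prop) (t₀, x t₀)
      rw [sub_self, abs_zero, mul_zero] at this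
      exact this.mono_left (hl.trans nhdsWithin_le_nhds)
    have h3 : Tendsto (fun p : ℝ × Phase n => Y p t₀ - p.2) l (𝓝 0) := by
      refine squeeze_zero_norm' ?_ h2
      filter_upwards [hl self_mem_nhdsWithin] with p hp
      have := hlip p hp p.1 hp t₀ ht₀
      rwa [hY0 p hp] at this
    simpa using h3.add h1
  -- Every ultrafilter limit of the curves solves the modified equation through `(t₀, x t₀)`, hence
  -- is x; all of them share the Lipschitz constant B.
  have hpt : ∀ t ∈ Icc a b, Tendsto (fun p => Y p t) (𝓝[S] (t₀, x t₀)) (𝓝 (x t)) := by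
    intro t ht
    rw [tendsto_iff_ultrafilter]
    intro l hl
    have hbdd : ∀ s ∈ Icc a b, ∃ z, Tendsto (fun p => Y p s) l (𝓝 z) := by
      intro s hs
      have hmem : ∀ᶠ p in (l : Filter (ℝ × Phase n)),
          Y p s ∈ Metric.closedBall (x t₀) (B * |s - t₀| + 1) := by
        filter_upwards [Metric.tendsto_nhds.1 (hinit l hl) 1 one_pos, hl self_mem_nhdsWithin]
          with p hp hpS
        have := hlip p hpS t₀ ht₀ s hs
        rw [← dist_eq_norm] at this
        exact (dist_triangle _ _ _).trans (add_le_add this hp.le)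
      obtain ⟨z, -, hz⟩ := (isCompact_closedBall (x t₀) (B * |s - t₀| + 1)).ultrafilter_le_nhds
        (l.map fun p => Y p s) (by rw [le_principal_iff]; exact hmem)
      exact ⟨z, hz⟩
    choose! y hy using hbdd
    have hysol : IsSolutionOn univ F y (Icc a b) := fun s hs => ⟨mem_univ _,
      hasDerivWithinAt_of_tendsto ordConnected_Icc hs hy (L := B) (g := fun _ => F)
        (by filter_upwards [hl self_mem_nhdsWithin] with p hp using ⟨hY p hp, fun t _ => hB _⟩)
        ((hF.tendsto _).comp tendsto_snd)⟩
    have h0 : x t₀ = y t₀ := tendsto_nhds_unique (hinit l hl) (hy t₀ ht₀)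
    rw [eqOn_of_field_eq_near hsys.uniqueness hN hNΩ hFf ordConnected_Icc hx hxN' hysol ht₀ h0 ht]
    exact hy t ht
  have htube : ∀ U : Set (ℝ × Phase n), IsOpen U → ∀ J ⊆ Icc a b, IsCompact J →
      (∀ t ∈ J, (t, x t) ∈ U) →
      ∀ᶠ p in 𝓝 (t₀, x t₀), p.1 ∈ Icc a b → ∀ t ∈ J, (t, Y p t) ∈ U := by
    intro U hU J hJ hJc hJU
    have := hJc.eventually_forall_of_forall_eventually (x₀ := (t₀, x t₀))
      (P := fun p t => p ∈ S → t ∈ Icc a b → (t, Y p t) ∈ U) ?_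
    · filter_upwards [this] with p hp hpS t ht using hp t ht hpS (hJ ht)
    intro t ht
    have hlim : Tendsto (fun z : (ℝ × Phase n) × ℝ => (z.2, Y z.1 z.2))
        (𝓝 ((t₀, x t₀), t) ⊓ 𝓟 (S ×ˢ Icc a b)) (𝓝 (t, x t)) := by
      change Tendsto _ (𝓝[S ×ˢ Icc a b] ((t₀, x t₀), t)) _
      rw [nhdsWithin_prod_eq]
      have h2 : Tendsto (fun z : (ℝ × Phase n) × ℝ => z.2)
          (𝓝[S] (t₀, x t₀) ×ˢ 𝓝[Icc a b] t) (𝓝 t) :=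
        tendsto_snd.mono_right nhdsWithin_le_nhds
      refine h2.prodMk_nhds ?_
      have h1 : Tendsto (fun z : (ℝ × Phase n) × ℝ => Y z.1 t)
          (𝓝[S] (t₀, x t₀) ×ˢ 𝓝[Icc a b] t) (𝓝 (x t)) := (hpt t (hJ ht)).comp tendsto_fst
      have h3 : Tendsto (fun z : (ℝ × Phase n) × ℝ => B * |z.2 - t|)
          (𝓝[S] (t₀, x t₀) ×ˢ 𝓝[Icc a b] t) (𝓝 0) := by
        have : Tendsto (fun s : ℝ => B * |s - t|) (𝓝 t) (𝓝 (B * |t - t|)) :=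
          Continuous.tendsto (by fun_prop) t
        rw [sub_self, abs_zero, mul_zero] at this
        exact this.comp h2
      have h4 : Tendsto (fun z : (ℝ × Phase n) × ℝ => Y z.1 z.2 - Y z.1 t)
          (𝓝[S] (t₀, x t₀) ×ˢ 𝓝[Icc a b] t) (𝓝 0) := by
        refine squeeze_zero_norm' ?_ h3
        filter_upwards [prod_mem_prod self_mem_nhdsWithin self_mem_nhdsWithin] with z hz
        exact hlip z.1 hz.1 t (hJ ht) z.2 hz.2
      simpa using h4.add h1
    have := hlim.eventually (hU.mem_nhds (hJU t ht))
    rw [eventually_inf_principal] at this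
    filter_upwards [this] with z hz hS hI using hz ⟨hS, hI⟩
  refine ⟨Y, ?_, htube⟩
  filter_upwards [htube N hN (Icc a b) Subset.rfl isCompact_Icc hxN'] with p hp hpS
  exact ⟨hY0 p hpS, (hY p hpS).congr_field fun t ht => ⟨hNΩ (hp hpS t ht), hFf (hp hpS t ht)⟩⟩

/-! ### Mountain pass property and local boundedness of sublevel sets -/

section MountainPass

variable {E : Type*} [NormedAddCommGroup E] [InnerProductSpace ℝ E] [FiniteDimensional ℝ E]

/-- On a compact set, an Euler step along the negative gradient of a `C¹` function without critical
points in `{K ≤ g}` decreases `(g - K)⁺` by a fixed factor. -/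
theorem exists_euler_step {g : E → ℝ} (hg : ContDiff ℝ 1 g) {K Λ : ℝ}
    (hcrit : ∀ x, K ≤ g x → fderiv ℝ g x ≠ 0) (hQ : IsCompact {x | g x ≤ Λ}) :
    ∃ (φ : E → E) (c : ℝ), Continuous φ ∧ 0 ≤ c ∧ c < 1 ∧ (∀ x, g x ≤ K → φ x = x) ∧
      ∀ x, K ≤ g x → g x ≤ Λ → g (φ x) - K ≤ c * (g x - K) := by
  let G : E → E := fun x => (InnerProductSpace.toDual ℝ E).symm (fderiv ℝ g x)
  have hGc : Continuous G :=
    (InnerProductSpace.toDual ℝ E).symm.continuous.comp (hg.continuous_fderiv one_ne_zero)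
  have hGn : ∀ x, ‖G x‖ = ‖fderiv ℝ g x‖ := fun x => LinearIsometryEquiv.norm_map _ _
  have hGd : ∀ x, fderiv ℝ g x (G x) = ‖G x‖ ^ 2 := fun x => by
    rw [← real_inner_self_eq_norm_sq]
    exact (InnerProductSpace.toDual_symm_apply (𝕜 := ℝ) (x := G x) (y := fderiv ℝ g x)).symm
  have hQ' : IsCompact {x | g x ≤ Λ ∧ K ≤ g x} :=
    hQ.inter_right (isClosed_le continuous_const hg.continuous)
  obtain ⟨m, hm, hmG⟩ : ∃ m > 0, ∀ x, g x ≤ Λ → K ≤ g x → m ≤ ‖G x‖ := by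
    rcases {x | g x ≤ Λ ∧ K ≤ g x}.eq_empty_or_nonempty with h | h
    · exact ⟨1, one_pos, fun x h1 h2 => (h.le ⟨h1, h2⟩ : x ∈ (∅ : Set E)).elim⟩
    · obtain ⟨z, hz, hmin⟩ := hQ'.exists_isMinOn h (hGc.norm.continuousOn)
      exact ⟨‖G z‖, by rw [hGn]; exact norm_pos_iff.2 (hcrit z hz.2), fun x h1 h2 => hmin ⟨h1, h2⟩⟩
  obtain ⟨B, hB⟩ := hQ.exists_bound_of_continuousOn (f := fun x => (g x - K) • G x)
    ((hg.continuous.sub continuous_const).smul hGc).continuousOn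
  have hunif := hQ.uniformContinuousAt_of_continuousAt (fderiv ℝ g)
    (fun a _ => (hg.continuous_fderiv one_ne_zero).continuousAt)
    (Metric.dist_mem_uniformity (half_pos hm))
  obtain ⟨δ, hδ, hδu⟩ := Metric.mem_uniformity_dist.1 hunif
  -- The first bound keeps the step within δ, where the gradient changes by less than m / 2, so at
  -- least half of the linear decrease survives; the second keeps the factor 1 - s m² / 2
  -- nonnegative. Scaling the step by (g - K)⁺ fixes the points of g ≤ K.
  let s : ℝ := min (δ / (2 * (|B| + 1))) (1 / m ^ 2)
  have hs : 0 < s := by positivity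
  have hsB : s * |B| < δ := by
    have h1 : s * (2 * (|B| + 1)) ≤ δ := by
      rw [← le_div_iff₀ (by positivity)]; exact min_le_left _ _
    nlinarith [abs_nonneg B]
  have hsm : s * m ^ 2 ≤ 1 := by
    rw [← le_div_iff₀ (by positivity)]; exact min_le_right _ _
  refine ⟨fun x => x - (s * max (g x - K) 0) • G x, 1 - s * m ^ 2 / 2, ?_, by linarith,
    by have := mul_pos hs (pow_pos hm 2); linarith, fun x hx => ?_, fun x hKx hxΛ => ?_⟩
  · have := hg.continuous
    fun_prop
  · simp [max_eq_right (sub_nonpos.2 hx)]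
  · simp only
    rw [max_eq_left (sub_nonneg.2 hKx)]
    set y : E := x - (s * (g x - K)) • G x with hy
    have hyx : y - x = -((s * (g x - K)) • G x) := by rw [hy]; abel
    have hnorm : ‖y - x‖ = s * (g x - K) * ‖G x‖ := by
      rw [hyx, norm_neg, norm_smul, Real.norm_eq_abs,
        abs_of_nonneg (mul_nonneg hs.le (sub_nonneg.2 hKx))]
    have hdist : dist x y < δ := by
      rw [dist_comm, dist_eq_norm, hyx, norm_neg, mul_smul, norm_smul, Real.norm_eq_abs,
        abs_of_pos hs]
      exact lt_of_le_of_lt (by gcongr; exact (hB x hxΛ).trans (le_abs_self B)) hsB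
    have hmv := (convex_ball x δ).norm_image_sub_le_of_norm_fderiv_le' (f := g)
      (φ := fderiv ℝ g x) (C := m / 2) (y := y)
      (fun z _ => (hg.differentiable one_ne_zero).differentiableAt)
      (fun z hz => by
        rw [← dist_eq_norm, dist_comm]
        exact (hδu (a := x) (b := z) (by rw [dist_comm]; exact hz) hxΛ : dist _ _ < _).le)
      (Metric.mem_ball_self hδ) (by rwa [Metric.mem_ball, dist_comm])
    have h1 := (abs_le.1 (Real.norm_eq_abs _ ▸ hmv)).2
    rw [hnorm] at h1
    rw [hyx, map_neg, map_smul, hGd, smul_eq_mul] at h1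
    have hmx := hmG x hxΛ hKx
    have h2 : 0 ≤ s * (g x - K) := mul_nonneg hs.le (sub_nonneg.2 hKx)
    have h3 : m / 2 * ‖G x‖ ≤ ‖G x‖ ^ 2 / 2 := by nlinarith [norm_nonneg (G x)]
    have h4 : m ^ 2 ≤ ‖G x‖ ^ 2 := by gcongr
    have h5 : s * (g x - K) * (m / 2 * ‖G x‖) ≤ s * (g x - K) * (‖G x‖ ^ 2 / 2) := by gcongr
    have h6 : s * (g x - K) * m ^ 2 ≤ s * (g x - K) * ‖G x‖ ^ 2 := by gcongr
    nlinarith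

/-- A coercive `C¹` function without critical points in `{K ≤ g}` has the mountain pass property:
two points of `{g ≤ K}` can be joined inside `{g < K'}` for every `K' > K`. -/
theorem exists_isPreconnected_sublevel {g : E → ℝ} (hg : ContDiff ℝ 1 g)
    (hcoer : Tendsto g (Bornology.cobounded E) atTop) {K K' : ℝ} (hK : K < K')
    (hcrit : ∀ x, K ≤ g x → fderiv ℝ g x ≠ 0) {e₁ e₂ : E} (h₁ : g e₁ ≤ K) (h₂ : g e₂ ≤ K) :
    ∃ Γ : Set E, IsPreconnected Γ ∧ e₁ ∈ Γ ∧ e₂ ∈ Γ ∧ ∀ x ∈ Γ, g x < K' := by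
  have hseg : IsCompact (segment ℝ e₁ e₂) := by
    rw [segment_eq_image_lineMap]
    exact isCompact_Icc.image AffineMap.lineMap_continuous
  obtain ⟨Λ, hΛ⟩ := hseg.bddAbove_image hg.continuous.continuousOn
  have hΛ' : ∀ x ∈ segment ℝ e₁ e₂, g x ≤ max Λ K :=
    fun x hx => le_max_of_le_left (hΛ (mem_image_of_mem g hx))
  have hQ : IsCompact {x | g x ≤ max Λ K} := by
    refine Metric.isCompact_of_isClosed_isBounded (isClosed_le hg.continuous continuous_const) ?_
    have : {x | g x ≤ max Λ K}ᶜ ∈ Bornology.cobounded E := by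
      filter_upwards [hcoer.eventually_gt_atTop (max Λ K)] with x hx using not_le.2 hx
    rwa [Bornology.isBounded_def]
  obtain ⟨φ, c, hφ, hc0, hc1, hfix, hdec⟩ := exists_euler_step hg hcrit hQ
  have hiter : ∀ k : ℕ, ∀ x ∈ segment ℝ e₁ e₂,
      g (φ^[k] x) ≤ K ∨ g (φ^[k] x) - K ≤ c ^ k * (max Λ K - K) := by
    intro k x hx
    induction k with
    | zero => right; simpa using hΛ' x hx
    | succ k ih =>
      rw [Function.iterate_succ_apply']
      rcases le_or_gt (g (φ^[k] x)) K with h | h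
      · left; rwa [hfix _ h]
      · right
        have h1 := ih.resolve_left (not_le.2 h)
        have h2 : c ^ k * (max Λ K - K) ≤ 1 * (max Λ K - K) := by
          gcongr
          · exact sub_nonneg.2 (le_max_right _ _)
          · exact pow_le_one₀ hc0 hc1.le
        have h3 := hdec _ h.le (by linarith)
        calc g (φ (φ^[k] x)) - K ≤ c * (g (φ^[k] x) - K) := h3
          _ ≤ c * (c ^ k * (max Λ K - K)) := by gcongr
          _ = c ^ (k + 1) * (max Λ K - K) := by ring
  have hlim : Tendsto (fun k : ℕ => c ^ k * (max Λ K - K)) atTop (𝓝 (0 * (max Λ K - K))) :=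
    (tendsto_pow_atTop_nhds_zero_of_lt_one hc0 hc1).mul_const _
  rw [zero_mul] at hlim
  obtain ⟨k, hk⟩ := (hlim.eventually_lt_const (sub_pos.2 hK)).exists
  have hfix' : ∀ x, g x ≤ K → φ^[k] x = x := fun x hx => Function.iterate_fixed (hfix x hx) k
  -- The Euler map pushes the segment down towards level K while its endpoints stay fixed; enough
  -- iterations bring it below K'.
  refine ⟨φ^[k] '' segment ℝ e₁ e₂,
    (convex_segment e₁ e₂).isPreconnected.image _ (hφ.iterate k).continuousOn,
    ⟨e₁, left_mem_segment _ _ _, hfix' _ h₁⟩, ⟨e₂, right_mem_segment _ _ _, hfix' _ h₂⟩, ?_⟩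
  rintro _ ⟨x, hx, rfl⟩
  rcases hiter k x hx with h | h <;> linarith

end MountainPass

/-- The sublevel sets of `V_t` are bounded locally uniformly in `t`. -/
theorem IsRegularSpatiallyCoercive.isBounded_sublevel {V : ℝ × Phase n → ℝ}
    (hV : IsRegularSpatiallyCoercive V) (a b K : ℝ) :
    Bornology.IsBounded {p : ℝ × Phase n | p.1 ∈ Icc a b ∧ V p ≤ K} := by
  wlog hK : 0 < K generalizing K
  · exact (this 1 one_pos).subset fun p hp => ⟨hp.1, hp.2.trans (by linarith)⟩
  have hloc : ∀ t : ℝ, ∃ R, ∀ᶠ s in 𝓝 t, ∀ x, V (s, x) ≤ K → ‖x‖ ≤ R := by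
    intro t
    have h1 := (hV.coercive t).eventually_gt_atTop (K + 1)
    rw [← comap_norm_atTop, eventually_comap] at h1
    obtain ⟨R, hR⟩ := eventually_atTop.1 h1
    obtain ⟨z, hz⟩ := hV.zero_level_nonempty t
    have hzR : ‖z‖ < R := by
      by_contra! h
      have := hR _ h z rfl
      linarith
    have hev1 : ∀ᶠ s in 𝓝 t, V (s, z) < K := by
      have : ContinuousAt (fun s => V (s, z)) t :=
        (hV.continuous.comp (by fun_prop)).continuousAt
      exact this.eventually_lt_const (by simpa [hz] using hK)
    have hev2 : ∀ᶠ s in 𝓝 t, ∀ x ∈ Metric.sphere (0 : Phase n) R, K + 1 < V (s, x) := by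
      refine (isCompact_sphere (0 : Phase n) R).eventually_forall_of_forall_eventually fun x hx => ?_
      exact hV.continuous.continuousAt.eventually_const_lt
        (hR R le_rfl x (by simpa using hx))
    refine ⟨R, ?_⟩
    filter_upwards [hev1, hev2] with s hs1 hs2 x hx
    by_contra! hxR
    -- A point of V_s ≤ K beyond the sphere of radius R could be joined to z below level K + 1; the
    -- connecting set would cross the sphere, where V_s > K + 1.
    have hCs : ContDiff ℝ 1 fun y : Phase n => V (s, y) :=
      hV.contDiff.comp (contDiff_prodMk_right s)
    obtain ⟨Γ, hΓ, hzΓ, hxΓ, hlt⟩ := exists_isPreconnected_sublevel hCs (hV.coercive s)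
      (lt_add_one K) (fun y hy => hV.gradient_ne_zero s y (hK.trans_le hy)) hs1.le hx
    obtain ⟨y, hy, hyR⟩ := hΓ.intermediate_value hzΓ hxΓ continuous_norm.continuousOn
      ⟨hzR.le, hxR.le⟩
    exact absurd (hlt y hy) (not_lt.2 (hs2 y (by simpa using hyR)).le)
  refine isCompact_Icc.induction_on
    (p := fun J => Bornology.IsBounded {p : ℝ × Phase n | p.1 ∈ J ∧ V p ≤ K}) ?_ ?_ ?_ ?_
  · simp
  · exact fun s t hst ht => ht.subset fun p hp => ⟨hst hp.1, hp.2⟩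
  · exact fun s t hs ht => (hs.union ht).subset fun p hp =>
      hp.1.imp (fun h => ⟨h, hp.2⟩) fun h => ⟨h, hp.2⟩
  · intro t _
    obtain ⟨R, hR⟩ := hloc t
    refine ⟨_, mem_nhdsWithin_of_mem_nhds (inter_mem hR (Metric.ball_mem_nhds t one_pos)), ?_⟩
    refine ((Metric.isBounded_ball (x := t) (r := 1)).prod
      (Metric.isBounded_closedBall (x := (0 : Phase n)) (r := R))).subset ?_
    rintro ⟨s, x⟩ ⟨⟨h1, h2⟩, h3⟩
    exact ⟨h2, by simpa using h1 x h3⟩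

/-! ### Consequences of condition (A) -/

variable {Ω 𝒲 : Set (ℝ × Phase n)} {f : ℝ × Phase n → Phase n}
  {V W : ℝ × Phase n → ℝ} {wLow wUp cUp : ℝ} {cLow : ℝ≥0∞}

namespace ConditionA

theorem subset (hA : ConditionA Ω f V W wLow wUp cLow cUp 𝒲) :
    𝒲 ⊆ {q ∈ Ω | W q ∈ Ioo wLow wUp} := by
  obtain ⟨p, -, rfl⟩ := hA.component
  exact connectedComponentIn_subset _ _

theorem isOpen (hA : ConditionA Ω f V W wLow wUp cLow cUp 𝒲) (hΩ : IsOpen Ω)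
    (hW : ContinuousOn W Ω) : IsOpen 𝒲 := by
  obtain ⟨p, -, rfl⟩ := hA.component
  exact (hW.isOpen_inter_preimage hΩ isOpen_Ioo).connectedComponentIn

/-- Adding a closure point to a connected set keeps it connected, so a component is closed relative
to the set of which it is a component. -/
theorem mem_of_mem_closure (hA : ConditionA Ω f V W wLow wUp cLow cUp 𝒲) {p : ℝ × Phase n}
    (hp : p ∈ closure 𝒲) (hpΩ : p ∈ Ω) (hpW : W p ∈ Ioo wLow wUp) : p ∈ 𝒲 := by
  have hsub := hA.subset
  obtain ⟨q, hq, rfl⟩ := hA.component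
  have hpre := isPreconnected_connectedComponentIn.subset_closure (subset_insert p _)
    (insert_subset hp subset_closure)
  exact hpre.subset_connectedComponentIn (mem_insert_of_mem _ (mem_connectedComponentIn hq))
    (insert_subset (show p ∈ {q ∈ Ω | W q ∈ Ioo wLow wUp} from ⟨hpΩ, hpW⟩) hsub)
    (mem_insert _ _)

theorem mem_Icc_of_mem_closure (hA : ConditionA Ω f V W wLow wUp cLow cUp 𝒲) (hΩ : IsOpen Ω)
    (hW : ContinuousOn W Ω) {p : ℝ × Phase n} (hp : p ∈ closure 𝒲) (hpΩ : p ∈ Ω) :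
    W p ∈ Icc wLow wUp := by
  have hc : ContinuousWithinAt W 𝒲 p := (hW.continuousAt (hΩ.mem_nhds hpΩ)).continuousWithinAt
  have := hc.mem_closure hp (t := Ioo wLow wUp) fun q hq => (hA.subset hq).2
  exact closure_minimal Ioo_subset_Icc_self isClosed_Icc this

theorem pos_of_notMem (hA : ConditionA Ω f V W wLow wUp cLow cUp 𝒲) {p : ℝ × Phase n}
    (hp : p ∉ 𝒲) : 0 < V p :=
  not_le.1 fun h => hp (hA.sublevel_subset h)

theorem mem_Ioo_of_eq_zero (hA : ConditionA Ω f V W wLow wUp cLow cUp 𝒲) {p : ℝ × Phase n}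
    (hp : V p = 0) : W p ∈ Ioo wLow wUp :=
  (hA.subset (hA.sublevel_subset hp.le)).2

theorem wMin_le (hA : ConditionA Ω f V W wLow wUp cLow cUp 𝒲) {t : ℝ} {x : Phase n}
    (hx : V (t, x) = 0) : wMin V W t ≤ W (t, x) :=
  csInf_le ⟨wLow, by rintro _ ⟨y, hy, rfl⟩; exact (hA.mem_Ioo_of_eq_zero hy).1.le⟩
    (mem_image_of_mem _ hx)

theorem le_wMax (hA : ConditionA Ω f V W wLow wUp cLow cUp 𝒲) {t : ℝ} {x : Phase n}
    (hx : V (t, x) = 0) : W (t, x) ≤ wMax V W t :=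
  le_csSup ⟨wUp, by rintro _ ⟨y, hy, rfl⟩; exact (hA.mem_Ioo_of_eq_zero hy).2.le⟩
    (mem_image_of_mem _ hx)

theorem le_wMin (hA : ConditionA Ω f V W wLow wUp cLow cUp 𝒲) (hV : IsSpatiallyCoercive V)
    (t : ℝ) : wLow ≤ wMin V W t :=
  le_csInf (Nonempty.image _ (hV.zero_level_nonempty t)) (by
    rintro _ ⟨y, hy, rfl⟩; exact (hA.mem_Ioo_of_eq_zero hy).1.le)

theorem wMax_le (hA : ConditionA Ω f V W wLow wUp cLow cUp 𝒲) (hV : IsSpatiallyCoercive V)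
    (t : ℝ) : wMax V W t ≤ wUp :=
  csSup_le (Nonempty.image _ (hV.zero_level_nonempty t)) (by
    rintro _ ⟨y, hy, rfl⟩; exact (hA.mem_Ioo_of_eq_zero hy).2.le)

theorem wMin_le_wMax (hA : ConditionA Ω f V W wLow wUp cLow cUp 𝒲) (hV : IsSpatiallyCoercive V)
    (t : ℝ) : wMin V W t ≤ wMax V W t := by
  obtain ⟨x, hx⟩ := hV.zero_level_nonempty t
  exact (hA.wMin_le hx).trans (hA.le_wMax hx)

theorem omegaMin_le (hA : ConditionA Ω f V W wLow wUp cLow cUp 𝒲) (hV : IsSpatiallyCoercive V)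
    (t : ℝ) : omegaMin V W ≤ wMin V W t :=
  ciInf_le ⟨wLow, by rintro _ ⟨s, rfl⟩; exact hA.le_wMin hV s⟩ t

theorem le_omegaMax (hA : ConditionA Ω f V W wLow wUp cLow cUp 𝒲) (hV : IsSpatiallyCoercive V)
    (t : ℝ) : wMax V W t ≤ omegaMax V W :=
  le_ciSup (f := fun t => wMax V W t) ⟨wUp, by rintro _ ⟨s, rfl⟩; exact hA.wMax_le hV s⟩ t

theorem omegaMin_le_wUp (hA : ConditionA Ω f V W wLow wUp cLow cUp 𝒲)
    (hV : IsSpatiallyCoercive V) : omegaMin V W ≤ wUp :=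
  (hA.omegaMin_le hV 0).trans ((hA.wMin_le_wMax hV 0).trans (hA.wMax_le hV 0))

end ConditionA

/-! ### Functions along solutions -/

theorem IsSolutionOn.hasDerivWithinAt_comp {x : ℝ → Phase n} {I : Set ℝ}
    (hx : IsSolutionOn Ω f x I) {U : ℝ × Phase n → ℝ} {t : ℝ} (ht : t ∈ I)
    (hU : DifferentiableAt ℝ U (t, x t)) :
    HasDerivWithinAt (fun s => U (s, x s)) (flowDeriv f U (t, x t)) I t :=
  hU.hasFDerivAt.comp_hasDerivWithinAt t ((hasDerivWithinAt_id t I).prodMk (hx t ht).2)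

theorem IsSolutionOn.continuousOn_comp {x : ℝ → Phase n} {I : Set ℝ}
    (hx : IsSolutionOn Ω f x I) {U : ℝ × Phase n → ℝ} (hU : ContinuousOn U Ω) :
    ContinuousOn (fun s => U (s, x s)) I :=
  hU.comp (continuousOn_id.prodMk hx.continuousOn) fun t ht => (hx t ht).1

namespace IsVWPair

theorem continuous (hVW : IsVWPair Ω f V W) : Continuous V := hVW.regular.continuous

theorem continuousOn (hVW : IsVWPair Ω f V W) : ContinuousOn W Ω :=
  hVW.guiding.contDiffOn.continuousOn

theorem differentiableAt (hVW : IsVWPair Ω f V W) (p : ℝ × Phase n) : DifferentiableAt ℝ V p :=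
  hVW.regular.contDiff.differentiable one_ne_zero p

theorem differentiableAt_guiding (hVW : IsVWPair Ω f V W) (hΩ : IsOpen Ω) {p : ℝ × Phase n}
    (hp : p ∈ Ω) : DifferentiableAt ℝ W p :=
  (hVW.guiding.contDiffOn.differentiableOn one_ne_zero).differentiableAt (hΩ.mem_nhds hp)

theorem strictMonoOn (hVW : IsVWPair Ω f V W) (hΩ : IsOpen Ω) {x : ℝ → Phase n} {a b : ℝ}
    (hx : IsSolutionOn Ω f x (Icc a b)) (hpos : ∀ t ∈ Ioo a b, 0 < V (t, x t)) :
    StrictMonoOn (fun t => W (t, x t)) (Icc a b) := by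
  refine strictMonoOn_of_hasDerivWithinAt_pos (convex_Icc a b)
    (hx.continuousOn_comp hVW.continuousOn) (f' := fun t => flowDeriv f W (t, x t)) ?_ ?_ <;>
    rw [interior_Icc] <;> intro t ht
  · have hx' := hx.mono (Ioo_subset_Icc_self (a := a) (b := b))
    exact hx'.hasDerivWithinAt_comp ht (hVW.differentiableAt_guiding hΩ (hx' t ht).1)
  · exact hVW.guiding.flowDeriv_pos _ (hx t (Ioo_subset_Icc_self ht)).1 (hpos t ht)

theorem antitoneOn (hVW : IsVWPair Ω f V W) (hΩ : IsOpen Ω)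
    (hA : ConditionA Ω f V W wLow wUp cLow cUp 𝒲) {x : ℝ → Phase n} {a b : ℝ}
    (hx : IsSolutionOn Ω f x (Icc a b)) (hx𝒲 : ∀ t ∈ Ioo a b, (t, x t) ∈ 𝒲)
    (hpos : ∀ t ∈ Ioo a b, 0 < V (t, x t)) :
    AntitoneOn (fun t => V (t, x t) - cUp * W (t, x t)) (Icc a b) := by
  refine antitoneOn_of_hasDerivWithinAt_nonpos (convex_Icc a b)
    ((hx.continuousOn_comp hVW.continuous.continuousOn).sub
      (continuousOn_const.mul (hx.continuousOn_comp hVW.continuousOn)))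
    (f' := fun t => flowDeriv f V (t, x t) - cUp * flowDeriv f W (t, x t)) ?_ ?_ <;>
    rw [interior_Icc] <;> intro t ht
  · have hx' := hx.mono (Ioo_subset_Icc_self (a := a) (b := b))
    exact (hx'.hasDerivWithinAt_comp ht (hVW.differentiableAt _)).sub
      ((hx'.hasDerivWithinAt_comp ht (hVW.differentiableAt_guiding hΩ (hx' t ht).1)).const_mul _)
  · exact sub_nonpos.2 (hA.upper_ineq _ (hx𝒲 t ht) (hpos t ht).le)

theorem monotoneOn (hVW : IsVWPair Ω f V W) (hΩ : IsOpen Ω)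
    (hA : ConditionA Ω f V W wLow wUp cLow cUp 𝒲) (hcLow : cLow ≠ ⊤) {x : ℝ → Phase n} {a b : ℝ}
    (hx : IsSolutionOn Ω f x (Icc a b)) (hx𝒲 : ∀ t ∈ Ioo a b, (t, x t) ∈ 𝒲)
    (hpos : ∀ t ∈ Ioo a b, 0 < V (t, x t)) :
    MonotoneOn (fun t => V (t, x t) + cLow.toReal * W (t, x t)) (Icc a b) := by
  refine monotoneOn_of_hasDerivWithinAt_nonneg (convex_Icc a b)
    ((hx.continuousOn_comp hVW.continuous.continuousOn).add
      (continuousOn_const.mul (hx.continuousOn_comp hVW.continuousOn)))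
    (f' := fun t => flowDeriv f V (t, x t) + cLow.toReal * flowDeriv f W (t, x t)) ?_ ?_ <;>
    rw [interior_Icc] <;> intro t ht
  · have hx' := hx.mono (Ioo_subset_Icc_self (a := a) (b := b))
    exact (hx'.hasDerivWithinAt_comp ht (hVW.differentiableAt _)).add
      ((hx'.hasDerivWithinAt_comp ht (hVW.differentiableAt_guiding hΩ (hx' t ht).1)).const_mul _)
  · have := hA.lower_ineq _ (hx𝒲 t ht) (hpos t ht).le hcLow
    linarith

end IsVWPair

theorem exists_last_zero {h : ℝ → ℝ} {a b : ℝ} (hab : a ≤ b) (hc : ContinuousOn h (Icc a b))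
    (ha : h a ≤ 0) (hb : 0 < h b) : ∃ s ∈ Ico a b, h s = 0 ∧ ∀ u ∈ Ioc s b, 0 < h u := by
  have hne : (Icc a b ∩ h ⁻¹' {0}).Nonempty := by
    obtain ⟨s, hs, hs0⟩ := intermediate_value_Icc hab hc ⟨ha, hb.le⟩
    exact ⟨s, hs, hs0⟩
  have hcpt : IsCompact (Icc a b ∩ h ⁻¹' {0}) :=
    isCompact_Icc.of_isClosed_subset (hc.preimage_isClosed_of_isClosed isClosed_Icc
      isClosed_singleton) inter_subset_left
  obtain ⟨s, ⟨hs, hs0⟩, hmax⟩ := hcpt.exists_isGreatest hne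
  have hs0 : h s = 0 := hs0
  refine ⟨s, ⟨hs.1, lt_of_le_of_ne hs.2 fun e => ?_⟩, hs0, fun u hu => ?_⟩
  · rw [e] at hs0
    linarith
  · by_contra! hu0
    have hsub : Icc u b ⊆ Icc a b := Icc_subset_Icc_left (hs.1.trans hu.1.le)
    obtain ⟨v, hv, hv0⟩ := intermediate_value_Icc hu.2 (hc.mono hsub) ⟨hu0, hb.le⟩
    exact absurd (hmax ⟨hsub hv, hv0⟩) (not_le.2 (hu.1.trans_le hv.1))

theorem exists_first_zero {h : ℝ → ℝ} {a b : ℝ} (hab : a ≤ b) (hc : ContinuousOn h (Icc a b))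
    (ha : 0 < h a) (hb : h b ≤ 0) : ∃ s ∈ Ioc a b, h s = 0 ∧ ∀ u ∈ Ico a s, 0 < h u := by
  obtain ⟨s, hs, hs0, hpos⟩ := exists_last_zero (h := fun u => h (-u)) (neg_le_neg hab)
    (hc.comp continuousOn_neg fun u hu => ⟨le_neg.1 hu.2, neg_le.1 hu.1⟩)
    (by simpa using hb) (by simpa using ha)
  refine ⟨-s, ⟨lt_neg.1 hs.2, neg_le.1 hs.1⟩, hs0, fun u hu => ?_⟩
  have := hpos (-u) ⟨lt_neg.1 hu.2, neg_le_neg hu.1⟩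
  rwa [neg_neg] at this

/-- The a priori bound for `V` along solutions in `𝒲`. -/
theorem IsVWPair.apply_le (hVW : IsVWPair Ω f V W) (hΩ : IsOpen Ω)
    (hA : ConditionA Ω f V W wLow wUp cLow cUp 𝒲) {x : ℝ → Phase n} {t₀ t r : ℝ} (ht : t₀ ≤ t)
    (hx : IsSolutionOn Ω f x (Icc t₀ t)) (hx𝒲 : ∀ s ∈ Ioo t₀ t, (s, x s) ∈ 𝒲)
    (hWt : W (t, x t) ≤ wUp) (hr : -(cUp * omegaMin V W) ≤ r)
    (h0 : 0 < V (t₀, x t₀) → V (t₀, x t₀) - cUp * W (t₀, x t₀) ≤ r) :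
    V (t, x t) ≤ cUp * wUp + r := by
  have hcW : cUp * W (t, x t) ≤ cUp * wUp := mul_le_mul_of_nonneg_left hWt hA.cUp_pos.le
  have hcont : ContinuousOn (fun s => V (s, x s)) (Icc t₀ t) :=
    hx.continuousOn_comp hVW.continuous.continuousOn
  -- The claimed bound is nonnegative because ω_0 ≤ w^*. If V > 0 at t, the decrease of V - c^*W is
  -- used from the last zero of V, where W ≥ ω_0, or from t₀ if there is none.
  rcases le_or_gt (V (t, x t)) 0 with h | h
  · have := mul_le_mul_of_nonneg_left (hA.omegaMin_le_wUp hVW.regular.toIsSpatiallyCoercive)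
      hA.cUp_pos.le
    linarith
  by_cases hz : ∃ s ∈ Icc t₀ t, V (s, x s) ≤ 0
  · obtain ⟨s₀, hs₀, hs₀V⟩ := hz
    obtain ⟨s, hs, hs0, hpos⟩ := exists_last_zero hs₀.2
      (hcont.mono (Icc_subset_Icc_left hs₀.1)) hs₀V h
    have hts : t₀ ≤ s := hs₀.1.trans hs.1
    have hanti := hVW.antitoneOn hΩ hA (hx.mono (Icc_subset_Icc_left hts))
      (fun u hu => hx𝒲 u ⟨hts.trans_lt hu.1, hu.2⟩) (fun u hu => hpos u ⟨hu.1, hu.2.le⟩)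
      (left_mem_Icc.2 hs.2.le) (right_mem_Icc.2 hs.2.le) hs.2.le
    have hWs := (hA.omegaMin_le hVW.regular.toIsSpatiallyCoercive s).trans (hA.wMin_le hs0)
    have := mul_le_mul_of_nonneg_left hWs hA.cUp_pos.le
    simp only [hs0] at hanti
    linarith
  · push Not at hz
    have hanti := hVW.antitoneOn hΩ hA hx hx𝒲 (fun u hu => hz u (Ioo_subset_Icc_self hu))
      (left_mem_Icc.2 ht) (right_mem_Icc.2 ht) ht
    have := h0 (hz t₀ (left_mem_Icc.2 ht))
    simp only at hanti
    linarith

/-! ### The exit alternative and Ważewski's principle -/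

theorem closure_inter_sublevel_subset (hVc : Continuous V)
    (hA : ConditionA Ω f V W wLow wUp cLow cUp 𝒲) {Vs : ℝ}
    (hcls : closure ({p | V p ∈ Ico 0 Vs} ∩ 𝒲) ⊆ Ω) : closure (𝒲 ∩ {p | V p < Vs}) ⊆ Ω := by
  have hsub : 𝒲 ∩ {p | V p < Vs} ⊆ {p | V p ≤ 0} ∪ closure ({p | V p ∈ Ico 0 Vs} ∩ 𝒲) := by
    rintro p ⟨hp, hpV⟩
    rcases le_or_gt (V p) 0 with h | h
    · exact Or.inl h
    · exact Or.inr (subset_closure ⟨⟨h.le, hpV⟩, hp⟩)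
  refine (closure_minimal hsub ((isClosed_le hVc continuous_const).union isClosed_closure)).trans
    (union_subset (fun p hp => (hA.subset (hA.sublevel_subset hp)).1) hcls)

/-- Coercivity uniform over [a,b] makes the slab bounded. When the closure involved lies in Ω, f can
be replaced by a compactly supported field without changing it near the slab. -/
theorem isCompact_slab (hV : IsRegularSpatiallyCoercive V) (a b Vs : ℝ) :
    IsCompact {p : ℝ × Phase n | p.1 ∈ Icc a b ∧ p ∈ closure (𝒲 ∩ {p | V p < Vs})} := by
  refine Metric.isCompact_of_isClosed_isBounded
    ((isClosed_Icc.preimage continuous_fst).inter isClosed_closure)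
    ((hV.isBounded_sublevel a b Vs).subset fun p hp => ⟨hp.1, ?_⟩)
  exact closure_minimal (fun q hq => le_of_lt hq.2)
    (isClosed_le hV.continuous continuous_const) hp.2

/-- The solution `x` on `[t₀, τ]` stays in `𝒲` until it passes through the exit set at time `σ`. -/
structure IsExitingSolution (Ω : Set (ℝ × Phase n)) (f : ℝ × Phase n → Phase n)
    (W : ℝ × Phase n → ℝ) (wUp : ℝ) (𝒲 : Set (ℝ × Phase n)) (t₀ σ τ : ℝ) (x : ℝ → Phase n) :
    Prop where
  le : t₀ ≤ σ
  lt : σ < τ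
  isSolutionOn : IsSolutionOn Ω f x (Icc t₀ τ)
  mem : ∀ t ∈ Ico t₀ σ, (t, x t) ∈ 𝒲
  mem_exitSet : (σ, x σ) ∈ exitSet Ω W wUp 𝒲
  lt_apply : ∀ t ∈ Ioc σ τ, wUp < W (t, x t)

theorem ConditionA.notMem_exitSet (hA : ConditionA Ω f V W wLow wUp cLow cUp 𝒲)
    {p : ℝ × Phase n} (hp : p ∈ 𝒲) : p ∉ exitSet Ω W wUp 𝒲 :=
  fun h => (hA.subset hp).2.2.ne h.2.2

/-- At the first time outside 𝒲 ∩ {V < V^*} the a priori bound rules out V = V^*, and the growth of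
W rules out W = w_*. So W = w^* there; since V > 0 off 𝒲, W goes on growing, which makes the exit
strict. -/
theorem exists_staying_or_exiting (hsys : IsSystem Ω f) (hVW : IsVWPair Ω f V W)
    (hA : ConditionA Ω f V W wLow wUp cLow cUp 𝒲) {Vs r : ℝ}
    (hcl : closure (𝒲 ∩ {p | V p < Vs}) ⊆ Ω) (hr : -(cUp * omegaMin V W) ≤ r)
    (hrV : cUp * wUp + r < Vs) {t₀ T : ℝ} (hT : t₀ ≤ T) {x₀ : Phase n}
    (hx₀ : (t₀, x₀) ∈ 𝒲 ∪ exitSet Ω W wUp 𝒲)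
    (h0 : 0 < V (t₀, x₀) → V (t₀, x₀) - cUp * W (t₀, x₀) ≤ r) :
    (∃ x : ℝ → Phase n, x t₀ = x₀ ∧ IsSolutionOn Ω f x (Icc t₀ T) ∧
      ∀ t ∈ Icc t₀ T, (t, x t) ∈ 𝒲) ∨
    ∃ (σ τ : ℝ) (x : ℝ → Phase n), x t₀ = x₀ ∧ IsExitingSolution Ω f W wUp 𝒲 t₀ σ τ x := by
  have hΩ := hsys.isOpen
  have h𝒲o := hA.isOpen hΩ hVW.continuousOn
  have hVo : IsOpen {p | V p < Vs} := isOpen_lt hVW.continuous continuous_const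
  have hx₀Ω : (t₀, x₀) ∈ Ω := hx₀.elim (fun h => (hA.subset h).1) fun h => h.2.1
  have hx₀cl : (t₀, x₀) ∈ closure 𝒲 := hx₀.elim (fun h => subset_closure h) fun h => h.1.1
  have hx₀W : W (t₀, x₀) ≤ wUp := (hA.mem_Icc_of_mem_closure hΩ hVW.continuousOn hx₀cl hx₀Ω).2
  -- The slab reaches T + 1 so that a solution exiting exactly at T can still be followed a little
  -- beyond.
  obtain ⟨F, N, hF, hFc, hN, hKN, hNΩ, hFf⟩ := exists_field_eq_near hΩ hsys.continuousOn
    (isCompact_slab (𝒲 := 𝒲) hVW.regular t₀ (T + 1) Vs) (fun p hp => hcl hp.2)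
  have hKN' : ∀ t ∈ Icc t₀ (T + 1), ∀ y, (t, y) ∈ closure (𝒲 ∩ {p | V p < Vs}) → (t, y) ∈ N :=
    fun t ht y hy => hKN ⟨ht, hy⟩
  have ht₀ : t₀ ∈ Icc t₀ (T + 1) := ⟨le_rfl, by linarith⟩
  obtain ⟨y, hy0, hy⟩ := exists_solution_of_hasCompactSupport hF hFc ht₀ x₀
  have hyc : ContinuousOn (fun t => (t, y t)) (Icc t₀ (T + 1)) :=
    continuousOn_id.prodMk hy.continuousOn
  have hsolN : ∀ b ≤ T + 1, (∀ t ∈ Icc t₀ b, (t, y t) ∈ N) → IsSolutionOn Ω f y (Icc t₀ b) :=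
    fun b hb h => (hy.mono (Icc_subset_Icc_right hb)).congr_field
      fun t ht => ⟨hNΩ (h t ht), hFf (h t ht)⟩
  by_cases hstay : ∀ t ∈ Icc t₀ T, (t, y t) ∈ 𝒲 ∩ {p | V p < Vs}
  · exact Or.inl ⟨y, hy0, hsolN T (by linarith) fun t ht =>
      hKN' t ⟨ht.1, by linarith [ht.2]⟩ _ (subset_closure (hstay t ht)), fun t ht => (hstay t ht).1⟩
  right
  have hcpt : IsCompact (Icc t₀ T ∩ (fun t => (t, y t)) ⁻¹' (𝒲 ∩ {p | V p < Vs})ᶜ) :=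
    isCompact_Icc.of_isClosed_subset ((hyc.mono (Icc_subset_Icc_right
      (by linarith))).preimage_isClosed_of_isClosed isClosed_Icc
      (h𝒲o.inter hVo).isClosed_compl) inter_subset_left
  obtain ⟨σ, ⟨hσ, hσU⟩, hσmin⟩ := hcpt.exists_isLeast (by
    push Not at hstay
    obtain ⟨t, ht, htU⟩ := hstay
    exact ⟨t, ht, htU⟩)
  have hσ1 : σ ∈ Icc t₀ (T + 1) := ⟨hσ.1, by linarith [hσ.2]⟩
  have hbefore : ∀ t ∈ Ico t₀ σ, (t, y t) ∈ 𝒲 ∩ {p | V p < Vs} := by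
    intro t ht
    by_contra hcon
    exact absurd (hσmin ⟨⟨ht.1, ht.2.le.trans hσ.2⟩, hcon⟩) (not_le.2 ht.2)
  -- The a priori bound applies to the degenerate interval [t₀, t₀], on which a constant curve
  -- counts as a solution.
  have hV₀ : V (t₀, x₀) < Vs :=
    lt_of_le_of_lt (hVW.apply_le (x := fun _ => x₀) hΩ hA le_rfl (fun s hs => by
      obtain rfl : s = t₀ := le_antisymm hs.2 hs.1
      exact ⟨hx₀Ω, by
        rw [Icc_self, hasDerivWithinAt_iff_tendsto_slope]; simp⟩) (by simp) hx₀W hr h0) hrV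
  have hσcl : (σ, y σ) ∈ closure (𝒲 ∩ {p | V p < Vs}) := by
    rcases hσ.1.eq_or_lt with h | h
    · rw [← h, hy0]
      exact hVo.closure_inter ⟨hx₀cl, hV₀⟩
    · have : σ ∈ closure (Ico t₀ σ) := by
        rw [closure_Ico h.ne]; exact right_mem_Icc.2 h.le
      exact ((hyc σ hσ1).mono (Ico_subset_Icc_self.trans
        (Icc_subset_Icc_right hσ1.2))).mem_closure this hbefore
  have hcl' : ∀ t ∈ Icc t₀ σ, (t, y t) ∈ closure (𝒲 ∩ {p | V p < Vs}) := by
    intro t ht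
    rcases ht.2.eq_or_lt with rfl | h
    · exact hσcl
    · exact subset_closure (hbefore t ⟨ht.1, h⟩)
  have hσcl𝒲 : (σ, y σ) ∈ closure 𝒲 := closure_mono inter_subset_left hσcl
  have hσΩ := hcl hσcl
  have hσW := hA.mem_Icc_of_mem_closure hΩ hVW.continuousOn hσcl𝒲 hσΩ
  have hsolσ : IsSolutionOn Ω f y (Icc t₀ σ) := hsolN σ hσ1.2 fun t ht =>
    hKN' t ⟨ht.1, ht.2.trans hσ1.2⟩ _ (hcl' t ht)
  have hσV : V (σ, y σ) < Vs := lt_of_le_of_lt (hVW.apply_le hΩ hA hσ.1 hsolσ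
    (fun s hs => (hbefore s ⟨hs.1.le, hs.2⟩).1) hσW.2 hr (by rwa [hy0])) hrV
  have hσ𝒲 : (σ, y σ) ∉ 𝒲 := fun h => hσU ⟨h, hσV⟩
  have hσpos : 0 < V (σ, y σ) := hA.pos_of_notMem hσ𝒲
  have hnear : ∀ᶠ t in 𝓝[Icc t₀ (T + 1)] σ, (t, y t) ∈ N ∧ 0 < V (t, y t) :=
    (hyc σ hσ1).eventually ((hN.eventually_mem (hKN' σ hσ1 _ hσcl)).and
      (hVW.continuous.continuousAt.eventually_const_lt hσpos))
  rw [eventually_nhdsWithin_iff, Metric.eventually_nhds_iff] at hnear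
  obtain ⟨δ, hδ, hball⟩ := hnear
  have hWσ : W (σ, y σ) = wUp := by
    by_contra hne
    have hlow : W (σ, y σ) = wLow := by
      by_contra hne'
      exact hσ𝒲 (hA.mem_of_mem_closure hσcl𝒲 hσΩ
        ⟨lt_of_le_of_ne hσW.1 (Ne.symm hne'), lt_of_le_of_ne hσW.2 hne⟩)
    have hlt : t₀ < σ := by
      refine lt_of_le_of_ne hσ.1 fun h => ?_
      rw [← h, hy0] at hlow hσ𝒲
      have := (hx₀.resolve_left hσ𝒲).2.2
      exact hA.w_lt.ne (hlow.symm.trans this)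
    -- Between s and σ one has V > 0, so W is smaller at s than at σ, that is, below w_*, although
    -- the point at time s is in 𝒲.
    let s := max t₀ (σ - δ / 2)
    have hs : s ∈ Ico t₀ σ := ⟨le_max_left _ _, max_lt hlt (by linarith)⟩
    have hmono := hVW.strictMonoOn hΩ (hsolσ.mono (Icc_subset_Icc_left hs.1)) (fun t ht =>
      (hball (by
        rw [Real.dist_eq, abs_sub_lt_iff]
        have : σ - δ / 2 ≤ s := le_max_right _ _
        constructor <;> linarith [ht.1, ht.2])
        ⟨hs.1.trans ht.1.le, ht.2.le.trans hσ1.2⟩).2)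
      (left_mem_Icc.2 hs.2.le) (right_mem_Icc.2 hs.2.le) hs.2
    have := (hA.subset (hbefore s hs).1).2.1
    simp only at hmono
    linarith
  let ε := min 1 (δ / 2)
  have hε : 0 < ε := by positivity
  have hε1 : ε ≤ 1 := min_le_left _ _
  have hεδ : ε ≤ δ / 2 := min_le_right _ _
  have hafter : ∀ t ∈ Icc σ (σ + ε), (t, y t) ∈ N ∧ 0 < V (t, y t) := fun t ht =>
    hball (by rw [Real.dist_eq, abs_sub_lt_iff]; constructor <;> linarith [ht.1, ht.2])
      ⟨hσ.1.trans ht.1, by linarith [ht.2, hσ.2]⟩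
  have hsol : IsSolutionOn Ω f y (Icc t₀ (σ + ε)) := by
    refine hsolN _ (by linarith [hσ.2]) fun t ht => ?_
    rcases le_total t σ with h | h
    · exact hKN' t ⟨ht.1, h.trans hσ1.2⟩ _ (hcl' t ⟨ht.1, h⟩)
    · exact (hafter t ⟨h, ht.2⟩).1
  refine ⟨σ, σ + ε, y, hy0, hσ.1, by linarith, hsol, fun t ht => (hbefore t ht).1,
    ⟨⟨hσcl𝒲, by rwa [h𝒲o.interior_eq]⟩, hσΩ, hWσ⟩, fun t ht => ?_⟩
  rw [← hWσ]
  exact hVW.strictMonoOn hΩ (hsol.mono (Icc_subset_Icc_left hσ.1))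
    (fun t ht => (hafter t (Ioo_subset_Icc_self ht)).2) (left_mem_Icc.2 (by linarith))
    (Ioc_subset_Icc_self ht) ht.1

section Exit

variable {M : Set (Phase n)} {t₀ : ℝ} {σ τ : Phase n → ℝ} {x : Phase n → ℝ → Phase n}

/-- The exit point depends continuously on the starting point. -/
theorem continuousOn_exitPoint (hsys : IsSystem Ω f) (hVW : IsVWPair Ω f V W)
    (hA : ConditionA Ω f V W wLow wUp cLow cUp 𝒲) (hx0 : ∀ z ∈ M, x z t₀ = z)
    (hx : ∀ z ∈ M, IsExitingSolution Ω f W wUp 𝒲 t₀ (σ z) (τ z) (x z)) :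
    ContinuousOn (fun z => (σ z, x z (σ z))) M := by
  intro z hz
  have hΩ := hsys.isOpen
  have h𝒲o := hA.isOpen hΩ hVW.continuousOn
  have hez := hx z hz
  have ht₀ : t₀ ∈ Icc t₀ (τ z) := ⟨le_rfl, hez.le.trans hez.lt.le⟩
  have hσz : σ z ∈ Icc t₀ (τ z) := ⟨hez.le, hez.lt.le⟩
  obtain ⟨Y, hY, hYU⟩ := exists_continuous_dependence hsys ht₀ hez.isSolutionOn
  rw [hx0 z hz] at hY hYU
  rw [ContinuousWithinAt, tendsto_nhds]
  intro U hU hUz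
  have hnear : ∀ᶠ t in 𝓝[Icc t₀ (τ z)] (σ z), (t, x z t) ∈ U :=
    (continuousWithinAt_id.prodMk (hez.isSolutionOn.continuousOn _ hσz)).eventually
      (hU.mem_nhds hUz)
  rw [eventually_nhdsWithin_iff, Metric.eventually_nhds_iff] at hnear
  obtain ⟨δ, hδ, hball⟩ := hnear
  let σ₂ := min (τ z) (σ z + δ / 2)
  have hσ₂ : σ₂ ∈ Ioc (σ z) (τ z) := ⟨lt_min hez.lt (by linarith), min_le_left _ _⟩
  have hσ₂δ : σ₂ ≤ σ z + δ / 2 := min_le_right _ _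
  have hJ : Icc (max t₀ (σ z - δ / 2)) σ₂ ⊆ Icc t₀ (τ z) :=
    Icc_subset_Icc (le_max_left _ _) hσ₂.2
  have hev1 := hYU U hU _ hJ isCompact_Icc fun t ht => hball (by
    have : σ z - δ / 2 ≤ t := (le_max_right _ _).trans ht.1
    rw [Real.dist_eq, abs_sub_lt_iff]
    constructor <;> linarith [ht.2]) (hJ ht)
  have hJ₀ : Icc t₀ (σ z - δ / 2) ⊆ Icc t₀ (τ z) :=
    Icc_subset_Icc_right (by linarith [hez.lt])
  -- Two open conditions confine the exit time of a nearby solution: it is still in 𝒲 up to σ z - δ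
  -- / 2 (vacuous if that precedes t₀), and it has W > w^* at σ₂, so it has left by then.
  have hev2 := hYU 𝒲 h𝒲o _ hJ₀ isCompact_Icc fun t ht =>
    hez.mem t ⟨ht.1, by linarith [ht.2]⟩
  have hσ₂I : σ₂ ∈ Icc t₀ (τ z) := ⟨hez.le.trans hσ₂.1.le, hσ₂.2⟩
  have hev3 := hYU _ (hVW.continuousOn.isOpen_inter_preimage hΩ (isOpen_Ioi (a := wUp)))
    {σ₂} (by simpa using hσ₂I) isCompact_singleton (by
      rintro t rfl
      exact ⟨(hez.isSolutionOn _ hσ₂I).1, hez.lt_apply _ hσ₂⟩)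
  have hcont : Tendsto (fun z' : Phase n => ((t₀, z') : ℝ × Phase n)) (𝓝[M] z) (𝓝 (t₀, z)) :=
    (Continuous.tendsto (by fun_prop) z).mono_left nhdsWithin_le_nhds
  filter_upwards [hcont.eventually hY, hcont.eventually hev1, hcont.eventually hev2,
    hcont.eventually hev3, self_mem_nhdsWithin] with z' h1 h2 h3 h4 hz'
  obtain ⟨hY0, hYs⟩ := h1 ht₀
  have h2 := h2 ht₀
  have h3 := h3 ht₀
  have h4 := (h4 ht₀ σ₂ rfl).2
  have hez' := hx z' hz'
  have heq : ∀ b ≤ τ z, b ≤ τ z' → ∀ t ∈ Icc t₀ b, Y (t₀, z') t = x z' t := by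
    intro b hb hb' t ht
    exact hsys.uniqueness (Icc t₀ b) _ _ ordConnected_Icc (hYs.mono (Icc_subset_Icc_right hb))
      (hez'.isSolutionOn.mono (Icc_subset_Icc_right hb')) t₀ (left_mem_Icc.2 (ht.1.trans ht.2))
      (hY0.trans (hx0 z' hz').symm) ht
  have hle : σ z' ≤ σ₂ := by
    by_contra! hcon
    have hm := hez'.mem σ₂ ⟨hσ₂I.1, hcon⟩
    rw [← heq σ₂ hσ₂.2 (hcon.le.trans hez'.lt.le) σ₂ (right_mem_Icc.2 hσ₂I.1)] at hm
    exact lt_asymm h4 (hA.subset hm).2.2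
  have heσ : Y (t₀, z') (σ z') = x z' (σ z') :=
    heq (σ z') (hle.trans hσ₂.2) hez'.lt.le _ (right_mem_Icc.2 hez'.le)
  have hge : σ z - δ / 2 < σ z' := by
    by_contra! hcon
    have hm := h3 (σ z') ⟨hez'.le, hcon⟩
    rw [heσ] at hm
    exact hA.notMem_exitSet hm hez'.mem_exitSet
  have := h2 (σ z') ⟨max_le hez'.le hge.le, hle⟩
  rwa [heσ] at this

/-- The starting point depends continuously on the exit point. -/
theorem isInducing_exitPoint (hsys : IsSystem Ω f) (hVW : IsVWPair Ω f V W)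
    (hA : ConditionA Ω f V W wLow wUp cLow cUp 𝒲) (hx0 : ∀ z ∈ M, x z t₀ = z)
    (hx : ∀ z ∈ M, IsExitingSolution Ω f W wUp 𝒲 t₀ (σ z) (τ z) (x z)) :
    IsInducing (M.domRestrict fun z => (σ z, x z (σ z))) := by
  rw [isInducing_iff_nhds]
  rintro ⟨z, hz⟩
  refine le_antisymm ?_ fun U hU => ?_
  · exact ((continuousOn_exitPoint hsys hVW hA hx0 hx).domRestrict.tendsto _).le_comap
  · rw [nhds_subtype, mem_comap] at hU
    obtain ⟨U', hU', hUU'⟩ := hU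
    obtain ⟨U'', hU''U', hU''o, hzU''⟩ := mem_nhds_iff.1 hU'
    have hez := hx z hz
    have hσz : σ z ∈ Icc t₀ (τ z) := ⟨hez.le, hez.lt.le⟩
    have ht₀ : t₀ ∈ Icc t₀ (τ z) := ⟨le_rfl, hez.le.trans hez.lt.le⟩
    -- Continuous dependence is now used from the exit point back to t₀. The margin σ z < τ z allows
    -- nearby exit times on either side of σ z.
    obtain ⟨Y, hY, hYU⟩ := exists_continuous_dependence hsys hσz hez.isSolutionOn
    have hev := hYU (univ ×ˢ U'') (isOpen_univ.prod hU''o) {t₀} (by simpa using ht₀)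
      isCompact_singleton (by rintro t rfl; exact ⟨mem_univ _, by rwa [hx0 z hz]⟩)
    have hτ : ∀ᶠ p : ℝ × Phase n in 𝓝 (σ z, x z (σ z)), p.1 < τ z :=
      continuousAt_fst.eventually_lt_const hez.lt
    rw [mem_comap]
    refine ⟨_, inter_mem hY (inter_mem hev hτ), ?_⟩
    rintro ⟨z', hz'⟩ ⟨h1, h2, h3⟩
    have hez' := hx z' hz'
    have hI : σ z' ∈ Icc t₀ (τ z) := ⟨hez'.le, le_of_lt h3⟩
    obtain ⟨hY0, hYs⟩ := h1 hI
    have h2 := (h2 hI t₀ rfl).2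
    have heq := hsys.uniqueness (Icc t₀ (σ z')) _ _ ordConnected_Icc
      (hYs.mono (Icc_subset_Icc_right hI.2))
      (hez'.isSolutionOn.mono (Icc_subset_Icc_right hez'.lt.le)) (σ z')
      (right_mem_Icc.2 hez'.le) hY0 (left_mem_Icc.2 hez'.le)
    simp only at h2 heq
    rw [heq, hx0 z' hz'] at h2
    exact hUU' (hU''U' h2)

/-- A positive delay before exit would put the starting point in 𝒲, which is disjoint from the exit
set. Hence the exit map fixes the exit points, as a retraction or the embedding in (C′) must. -/
theorem exitPoint_eq_of_mem_exitSet (hA : ConditionA Ω f V W wLow wUp cLow cUp 𝒲) {z : Phase n}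
    (hx0 : x z t₀ = z) (hx : IsExitingSolution Ω f W wUp 𝒲 t₀ (σ z) (τ z) (x z))
    (hz : (t₀, z) ∈ exitSet Ω W wUp 𝒲) : (σ z, x z (σ z)) = (t₀, z) := by
  have : σ z = t₀ := by
    by_contra hne
    have := hx.mem t₀ ⟨le_rfl, lt_of_le_of_ne hx.le (Ne.symm hne)⟩
    rw [hx0] at this
    exact hA.notMem_exitSet this hz
  rw [this, hx0]

end Exit

/-- **Ważewski's principle**: some solution starting in `M` stays in `𝒲` up to time `T`. -/
theorem exists_staying_solution (hsys : IsSystem Ω f) (hVW : IsVWPair Ω f V W)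
    (hA : ConditionA Ω f V W wLow wUp cLow cUp 𝒲) {Vs r : ℝ}
    (hcl : closure (𝒲 ∩ {p | V p < Vs}) ⊆ Ω) (hr : -(cUp * omegaMin V W) ≤ r)
    (hrV : cUp * wUp + r < Vs) {t₀ T : ℝ} (hT : t₀ ≤ T) {M : Set (Phase n)}
    (hM : ∀ x ∈ M, (t₀, x) ∈ 𝒲 ∪ exitSet Ω W wUp 𝒲)
    (h0 : ∀ x ∈ M, 0 < V (t₀, x) → V (t₀, x) - cUp * W (t₀, x) ≤ r)
    (hC : (IsRetractOf (exitPart (exitSet Ω W wUp 𝒲) t₀ M) {p ∈ exitSet Ω W wUp 𝒲 | t₀ ≤ p.1} ∧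
        ¬ IsRetractOf (exitPart (exitSet Ω W wUp 𝒲) t₀ M) ({t₀} ×ˢ M)) ∨
      ¬ ∃ g : M → ℝ × Phase n, IsEmbedding g ∧ (∀ x, g x ∈ exitSet Ω W wUp 𝒲) ∧
        ∀ x : M, (t₀, (x : Phase n)) ∈ exitSet Ω W wUp 𝒲 → g x = (t₀, (x : Phase n))) :
    ∃ x : ℝ → Phase n, IsSolutionOn Ω f x (Icc t₀ T) ∧
      ∀ t ∈ Icc t₀ T, (t, x t) ∈ 𝒲 ∧ V (t, x t) ≤ cUp * wUp + r := by
  by_contra hcon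
  have hexit : ∀ z ∈ M, ∃ (σ τ : ℝ) (x : ℝ → Phase n), x t₀ = z ∧
      IsExitingSolution Ω f W wUp 𝒲 t₀ σ τ x := by
    intro z hz
    refine (exists_staying_or_exiting hsys hVW hA hcl hr hrV hT (hM z hz) (h0 z hz)).resolve_left ?_
    rintro ⟨x, hx0, hx, hx𝒲⟩
    refine hcon ⟨x, hx, fun t ht => ⟨hx𝒲 t ht, hVW.apply_le hsys.isOpen hA ht.1
      (hx.mono (Icc_subset_Icc_right ht.2))
      (fun s hs => hx𝒲 s ⟨hs.1.le, hs.2.le.trans ht.2⟩) (hA.subset (hx𝒲 t ht)).2.2.le hr ?_⟩⟩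
    rw [hx0]
    exact h0 z hz
  choose! σ τ x hx0 hx using hexit
  rcases hC with ⟨⟨-, ρ, hρc, hρm, hρf⟩, hnot⟩ | hnot
  -- The exit map followed by the retraction ρ from (C) would retract {t₀} × M onto its exit part.
  · refine hnot ⟨fun p hp => ⟨hp.2.1, hp.2.2⟩, fun p => ρ (σ p.2, x p.2 (σ p.2)), ?_, ?_, ?_⟩
    · refine hρc.comp ((continuousOn_exitPoint hsys hVW hA hx0 hx).comp continuousOn_snd
        fun p hp => hp.2) fun p hp => ?_
      exact ⟨(hx _ hp.2).mem_exitSet, (hx _ hp.2).le⟩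
    · exact fun p hp => hρm ⟨(hx _ hp.2).mem_exitSet, (hx _ hp.2).le⟩
    · rintro ⟨t, z⟩ hp
      obtain ⟨hpS, ht, hz⟩ := id hp
      obtain rfl : t = t₀ := ht
      simp only
      rw [exitPoint_eq_of_mem_exitSet hA (hx0 z hz) (hx z hz) hpS]
      exact hρf _ hp
  -- Injectivity needs no separate proof: an inducing map on a T₀ space is an embedding.
  · exact hnot ⟨_, (isInducing_exitPoint hsys hVW hA hx0 hx).isEmbedding,
      fun z => (hx z z.2).mem_exitSet,
      fun z hz => exitPoint_eq_of_mem_exitSet hA (hx0 z z.2) (hx z z.2) hz⟩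

/-! ### Passage to a global solution -/

/-- A solution on the whole axis, obtained as a limit of solutions on expanding intervals. -/
theorem exists_global_solution (hsys : IsSystem Ω f) (hVW : IsVWPair Ω f V W)
    (hA : ConditionA Ω f V W wLow wUp cLow cUp 𝒲) {Vs K : ℝ}
    (hcl : closure (𝒲 ∩ {p | V p < Vs}) ⊆ Ω) (hK : K < Vs)
    (hloc : ∀ k : ℕ, ∃ x : ℝ → Phase n, IsSolutionOn Ω f x (Icc (-k) k) ∧
      ∀ t ∈ Icc (-k : ℝ) k, (t, x t) ∈ 𝒲 ∧ V (t, x t) ≤ K) :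
    ∃ x : ℝ → Phase n, IsSolutionOn Ω f x univ ∧ ∀ t, (t, x t) ∈ 𝒲 ∧ V (t, x t) ≤ K := by
  have hΩ := hsys.isOpen
  choose x hx hx𝒲 using hloc
  let l : Ultrafilter ℕ := Ultrafilter.of atTop
  have hl : (l : Filter ℕ) ≤ atTop := Ultrafilter.of_le _
  have hev : ∀ t : ℝ, ∀ᶠ k : ℕ in (l : Filter ℕ), |t| ≤ k := fun t =>
    hl ((tendsto_natCast_atTop_atTop (R := ℝ)).eventually_ge_atTop |t|)
  have hmem : ∀ a b : ℝ, ∀ᶠ k : ℕ in (l : Filter ℕ), ∀ t ∈ Icc a b,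
      t ∈ Icc (-k : ℝ) k ∧
      (t, x k t) ∈ {p : ℝ × Phase n | p.1 ∈ Icc a b ∧ p ∈ closure (𝒲 ∩ {p | V p < Vs})} := by
    intro a b
    filter_upwards [hev a, hev b] with k hka hkb t ht
    have htk : t ∈ Icc (-k : ℝ) k :=
      ⟨(neg_le_of_abs_le hka).trans ht.1, ht.2.trans (le_of_abs_le hkb)⟩
    exact ⟨htk, ht, subset_closure ⟨(hx𝒲 k t htk).1, (hx𝒲 k t htk).2.trans_lt hK⟩⟩
  have hlim : ∀ t : ℝ, ∃ z, Tendsto (fun k => x k t) l (𝓝 z) := by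
    intro t
    obtain ⟨p, -, hp⟩ := (isCompact_slab (𝒲 := 𝒲) hVW.regular t t Vs).ultrafilter_le_nhds
      (l.map fun k => (t, x k t)) (by
        rw [le_principal_iff, Ultrafilter.mem_coe, Ultrafilter.mem_map, ← Ultrafilter.mem_coe]
        exact mem_of_superset (hmem t t) fun k hk => (hk t ⟨le_rfl, le_rfl⟩).2)
    exact ⟨p.2, (continuous_snd.tendsto p).comp hp⟩
  choose y hy using hlim
  have hyt : ∀ t, Tendsto (fun k => (t, x k t)) l (𝓝 (t, y t)) :=
    fun t => tendsto_const_nhds.prodMk_nhds (hy t)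
  have hycl : ∀ t, (t, y t) ∈ closure (𝒲 ∩ {p | V p < Vs}) := fun t =>
    isClosed_closure.mem_of_tendsto (hyt t) (by
      filter_upwards [hmem t t] with k hk using (hk t ⟨le_rfl, le_rfl⟩).2.2)
  have hyV : ∀ t, V (t, y t) ≤ K := fun t =>
    le_of_tendsto ((hVW.continuous.tendsto _).comp (hyt t)) (by
      filter_upwards [hmem t t] with k hk using (hx𝒲 k t (hk t ⟨le_rfl, le_rfl⟩).1).2)
  have hysol : IsSolutionOn Ω f y univ := by
    intro s _
    refine ⟨hcl (hycl s), ?_⟩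
    have hcpt := isCompact_slab (𝒲 := 𝒲) hVW.regular (s - 1) (s + 1) Vs
    obtain ⟨L, hL⟩ := hcpt.exists_bound_of_continuousOn
      (hsys.continuousOn.mono fun p hp => hcl hp.2)
    have hs : s ∈ Icc (s - 1) (s + 1) := ⟨by linarith, by linarith⟩
    refine (HasDerivWithinAt.hasDerivAt (s := Icc (s - 1) (s + 1)) ?_
      (Icc_mem_nhds (by linarith) (by linarith))).hasDerivWithinAt
    refine hasDerivWithinAt_of_tendsto (l := (l : Filter ℕ)) ordConnected_Icc hs
      (fun t _ => hy t) (L := L) (g := fun _ => f) ?_ ?_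
    · filter_upwards [hmem (s - 1) (s + 1)] with k hk
      exact ⟨((hx k).mono fun t ht => (hk t ht).1).congr_field fun t _ => ⟨mem_univ _, rfl⟩,
        fun t ht => hL _ (hk t ht).2⟩
    · exact (hsys.continuousOn.continuousAt (hΩ.mem_nhds (hcl (hycl s)))).tendsto.comp tendsto_snd
  have hycl𝒲 : ∀ t, (t, y t) ∈ closure 𝒲 := fun t => closure_mono inter_subset_left (hycl t)
  have hyW : ∀ t, W (t, y t) ∈ Icc wLow wUp := fun t =>
    hA.mem_Icc_of_mem_closure hΩ hVW.continuousOn (hycl𝒲 t) (hcl (hycl t))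
  refine ⟨y, hysol, fun t => ⟨?_, hyV t⟩⟩
  -- The limit is known only to lie in the closure of 𝒲. At a point outside 𝒲 one has V > 0, so W
  -- increases strictly through time t while remaining in [w_*, w^*]; its value at t is then
  -- interior, and relative closedness puts the point in 𝒲.
  by_contra hnot
  have hVc : Continuous fun s => V (s, y s) :=
    continuousOn_univ.1 (hysol.continuousOn_comp hVW.continuous.continuousOn)
  obtain ⟨δ, hδ, hball⟩ := Metric.eventually_nhds_iff.1
    ((hVc.tendsto t).eventually_const_lt (hA.pos_of_notMem hnot))
  have hmono := hVW.strictMonoOn hΩ (hysol.mono (subset_univ (Icc (t - δ) (t + δ))))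
    (fun s hs => hball (by rw [Real.dist_eq, abs_sub_lt_iff]; constructor <;> linarith [hs.1, hs.2]))
  have ht : t ∈ Icc (t - δ) (t + δ) := ⟨by linarith, by linarith⟩
  have h1 := hmono (left_mem_Icc.2 (by linarith)) ht (by linarith)
  have h2 := hmono ht (right_mem_Icc.2 (by linarith)) (by linarith)
  exact hnot (hA.mem_of_mem_closure (hycl𝒲 t) (hcl (hycl t))
    ⟨(hyW (t - δ)).1.trans_lt h1, lt_of_lt_of_le h2 (hyW (t + δ)).2⟩)

/-! ### The function `alpha` -/

theorem IsVWPair.continuousOn_flowDeriv (hsys : IsSystem Ω f) (hVW : IsVWPair Ω f V W) :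
    ContinuousOn (flowDeriv f W) Ω :=
  (hVW.guiding.contDiffOn.continuousOn_fderiv_of_isOpen hsys.isOpen le_rfl).clm_apply
    (continuousOn_const.prodMk hsys.continuousOn)

theorem alpha_set_bddBelow (hVW : IsVWPair Ω f V W)
    (hA : ConditionA Ω f V W wLow wUp cLow cUp 𝒲) (t : ℝ) :
    0 ∈ lowerBounds ((fun x : Phase n => flowDeriv f W (t, x)) ''
      {x | 0 < V (t, x) ∧ (t, x) ∈ 𝒲}) := by
  rintro _ ⟨x, hx, rfl⟩
  exact (hVW.guiding.flowDeriv_pos _ (hA.subset hx.2).1 hx.1).le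

theorem alpha_nonneg (hVW : IsVWPair Ω f V W) (hA : ConditionA Ω f V W wLow wUp cLow cUp 𝒲)
    (t : ℝ) : 0 ≤ alpha f V W 𝒲 t :=
  Real.sInf_nonneg (alpha_set_bddBelow hVW hA t)

theorem alpha_le (hVW : IsVWPair Ω f V W) (hA : ConditionA Ω f V W wLow wUp cLow cUp 𝒲)
    {t : ℝ} {x : Phase n} (hV : 0 < V (t, x)) (hx : (t, x) ∈ 𝒲) :
    alpha f V W 𝒲 t ≤ flowDeriv f W (t, x) :=
  csInf_le ⟨0, alpha_set_bddBelow hVW hA t⟩ (mem_image_of_mem _ (And.intro hV hx))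

/-- The boundary of V_t ≤ 0 lies in the open set 𝒲 and is approached by points with V_t > 0. This
keeps α from being the default infimum of an empty set; positive dimension follows from the
nonvanishing gradient. -/
theorem exists_pos_mem (hsys : IsSystem Ω f) (hVW : IsVWPair Ω f V W)
    (hA : ConditionA Ω f V W wLow wUp cLow cUp 𝒲) (t : ℝ) :
    ∃ x : Phase n, 0 < V (t, x) ∧ (t, x) ∈ 𝒲 := by
  have : Nontrivial (Phase n) := by
    obtain ⟨p, -, hp⟩ := hVW.guiding.nonempty
    by_contra hsub
    rw [not_nontrivial_iff_subsingleton] at hsub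
    exact hVW.regular.gradient_ne_zero p.1 p.2 hp (Subsingleton.elim _ _)
  have hc : Continuous fun x : Phase n => V (t, x) := hVW.continuous.comp (by fun_prop)
  have hcl : IsClosed {x : Phase n | V (t, x) ≤ 0} := isClosed_le hc continuous_const
  have hfr : (frontier {x : Phase n | V (t, x) ≤ 0}).Nonempty := by
    rw [nonempty_frontier_iff]
    refine ⟨(hVW.regular.zero_level_nonempty t).imp fun x hx => hx.le, fun h => ?_⟩
    obtain ⟨x, hx⟩ := ((hVW.regular.coercive t).eventually_gt_atTop 0).exists
    exact not_le.2 hx (h.ge (mem_univ x))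
  obtain ⟨x, hx⟩ := hfr
  have hx𝒲 : (t, x) ∈ 𝒲 := hA.sublevel_subset (hcl.frontier_subset hx)
  rw [frontier_eq_closure_inter_closure] at hx
  obtain ⟨y, hy𝒲, hy⟩ := mem_closure_iff.1 hx.2 ((fun y => (t, y)) ⁻¹' 𝒲)
    ((hA.isOpen hsys.isOpen hVW.continuousOn).preimage (by fun_prop)) hx𝒲
  exact ⟨y, not_le.1 hy, hy𝒲⟩

/-- A point x nearly attaining the infimum at t remains admissible at nearby times, all the
conditions on it being open. Measurability and local boundedness of α follow. -/
theorem upperSemicontinuous_alpha (hsys : IsSystem Ω f) (hVW : IsVWPair Ω f V W)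
    (hA : ConditionA Ω f V W wLow wUp cLow cUp 𝒲) : UpperSemicontinuous (alpha f V W 𝒲) := by
  intro t c hc
  obtain ⟨x₁, hx₁⟩ := exists_pos_mem hsys hVW hA t
  obtain ⟨_, ⟨x, ⟨hxV, hx𝒲⟩, rfl⟩, hxc⟩ :=
    exists_lt_of_csInf_lt ⟨_, mem_image_of_mem (fun x : Phase n => flowDeriv f W (t, x)) hx₁⟩ hc
  have hpath : Tendsto (fun s : ℝ => (s, x)) (𝓝 t) (𝓝 (t, x)) :=
    Continuous.tendsto (by fun_prop) t
  have hxΩ := (hA.subset hx𝒲).1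
  filter_upwards [hpath.eventually ((hVW.continuousOn_flowDeriv hsys).continuousAt
      (hsys.isOpen.mem_nhds hxΩ) |>.eventually_lt_const hxc),
    hpath.eventually (hVW.continuous.continuousAt.eventually_const_lt hxV),
    hpath.eventually ((hA.isOpen hsys.isOpen hVW.continuousOn).eventually_mem hx𝒲)]
    with s h1 h2 h3
  exact (alpha_le hVW hA h2 h3).trans_lt h1

theorem integrableOn_alpha (hsys : IsSystem Ω f) (hVW : IsVWPair Ω f V W)
    (hA : ConditionA Ω f V W wLow wUp cLow cUp 𝒲) (a b : ℝ) :
    IntegrableOn (alpha f V W 𝒲) (Icc a b) := by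
  have husc := upperSemicontinuous_alpha hsys hVW hA
  obtain ⟨B, hB⟩ := (husc.upperSemicontinuousOn _).bddAbove_of_isCompact
    (isCompact_Icc (a := a) (b := b))
  refine Measure.integrableOn_of_bounded (M := B) (by simp) husc.measurable.aestronglyMeasurable ?_
  refine (ae_restrict_iff' measurableSet_Icc).2 (Eventually.of_forall fun t ht => ?_)
  rw [Real.norm_eq_abs, abs_of_nonneg (alpha_nonneg hVW hA t)]
  exact hB (mem_image_of_mem _ ht)

theorem intervalIntegrable_alpha (hsys : IsSystem Ω f) (hVW : IsVWPair Ω f V W)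
    (hA : ConditionA Ω f V W wLow wUp cLow cUp 𝒲) (a b : ℝ) :
    IntervalIntegrable (alpha f V W 𝒲) volume a b :=
  ((integrableOn_alpha hsys hVW hA _ _).mono_set Subset.rfl).intervalIntegrable

theorem integral_alpha_le (hsys : IsSystem Ω f) (hVW : IsVWPair Ω f V W)
    (hA : ConditionA Ω f V W wLow wUp cLow cUp 𝒲) {x : ℝ → Phase n} {a b : ℝ} (hab : a ≤ b)
    (hx : IsSolutionOn Ω f x (Icc a b)) (hx𝒲 : ∀ t ∈ Ioo a b, (t, x t) ∈ 𝒲)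
    (hpos : ∀ t ∈ Ioo a b, 0 < V (t, x t)) :
    ∫ s in a..b, alpha f V W 𝒲 s ≤ W (b, x b) - W (a, x a) := by
  refine intervalIntegral.integral_le_sub_of_hasDeriv_right_of_le hab
    (g := fun t => W (t, x t)) (g' := fun t => flowDeriv f W (t, x t))
    (hx.continuousOn_comp hVW.continuousOn) (fun t ht => ?_) (integrableOn_alpha hsys hVW hA a b)
    fun t ht => alpha_le hVW hA (hpos t ht) (hx𝒲 t ht)
  have ht' := Ioo_subset_Icc_self ht
  exact ((hx.hasDerivWithinAt_comp ht' (hVW.differentiableAt_guiding hsys.isOpen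
    (hx t ht').1)).hasDerivAt (Icc_mem_nhds ht.1 ht.2)).hasDerivWithinAt

theorem integral_alpha_nonneg (hVW : IsVWPair Ω f V W)
    (hA : ConditionA Ω f V W wLow wUp cLow cUp 𝒲) {a b : ℝ} (hab : a ≤ b) :
    0 ≤ ∫ s in a..b, alpha f V W 𝒲 s :=
  intervalIntegral.integral_nonneg hab fun t _ => alpha_nonneg hVW hA t

theorem tendsto_integral_alpha_atTop (hsys : IsSystem Ω f) (hVW : IsVWPair Ω f V W)
    (hA : ConditionA Ω f V W wLow wUp cLow cUp 𝒲) (hB : ConditionB f V W 𝒲) (t : ℝ) :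
    Tendsto (fun T => ∫ s in t..T, alpha f V W 𝒲 s) atTop atTop := by
  have hint := intervalIntegrable_alpha hsys hVW hA
  refine (tendsto_atTop_add_const_left _ (∫ s in t..0, alpha f V W 𝒲 s) hB.2).congr fun T => ?_
  exact intervalIntegral.integral_add_adjacent_intervals (hint _ _) (hint _ _)

theorem tendsto_integral_alpha_atBot (hsys : IsSystem Ω f) (hVW : IsVWPair Ω f V W)
    (hA : ConditionA Ω f V W wLow wUp cLow cUp 𝒲) (hB : ConditionB f V W 𝒲) (t : ℝ) :
    Tendsto (fun T => ∫ s in T..t, alpha f V W 𝒲 s) atBot atTop := by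
  have hint := intervalIntegrable_alpha hsys hVW hA
  refine (tendsto_atTop_add_const_right _ (∫ s in (0 : ℝ)..t, alpha f V W 𝒲 s) hB.1).congr
    fun T => ?_
  exact intervalIntegral.integral_add_adjacent_intervals (hint _ _) (hint _ _)

theorem ConditionA.omegaMin_le_omegaMax (hA : ConditionA Ω f V W wLow wUp cLow cUp 𝒲)
    (hV : IsSpatiallyCoercive V) : omegaMin V W ≤ omegaMax V W :=
  (hA.omegaMin_le hV 0).trans ((hA.wMin_le_wMax hV 0).trans (hA.le_omegaMax hV 0))

theorem exists_isTauPlus (hsys : IsSystem Ω f) (hVW : IsVWPair Ω f V W)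
    (hA : ConditionA Ω f V W wLow wUp cLow cUp 𝒲) (hB : ConditionB f V W 𝒲) (t : ℝ) :
    ∃ τ, IsTauPlus f V W 𝒲 t τ := by
  obtain ⟨T, hTt, hT⟩ := ((eventually_ge_atTop t).and
    ((tendsto_integral_alpha_atTop hsys hVW hA hB t).eventually_ge_atTop
      (omegaMax V W - omegaMin V W))).exists
  have hc := intervalIntegral.continuous_primitive (intervalIntegrable_alpha hsys hVW hA) t
  obtain ⟨τ, hτ, h⟩ := intermediate_value_Icc hTt hc.continuousOn ⟨by
    simpa using hA.omegaMin_le_omegaMax hVW.regular.toIsSpatiallyCoercive, hT⟩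
  exact ⟨τ, hτ.1, h⟩

theorem exists_isTauMinus (hsys : IsSystem Ω f) (hVW : IsVWPair Ω f V W)
    (hA : ConditionA Ω f V W wLow wUp cLow cUp 𝒲) (hB : ConditionB f V W 𝒲) (t : ℝ) :
    ∃ τ, IsTauMinus f V W 𝒲 t τ := by
  obtain ⟨T, hTt, hT⟩ := ((eventually_le_atBot t).and
    ((tendsto_integral_alpha_atBot hsys hVW hA hB t).eventually_ge_atTop
      (omegaMax V W - omegaMin V W))).exists
  have hc : Continuous fun T => ∫ s in T..t, alpha f V W 𝒲 s := by
    simp_rw [intervalIntegral.integral_symm t]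
    exact (intervalIntegral.continuous_primitive (intervalIntegrable_alpha hsys hVW hA) t).neg
  obtain ⟨τ, hτ, h⟩ := intermediate_value_Icc' hTt hc.continuousOn ⟨by
    simpa using hA.omegaMin_le_omegaMax hVW.regular.toIsSpatiallyCoercive, hT⟩
  exact ⟨τ, hτ.2, h⟩

/-! ### Excursions into V > 0 and the final estimates -/

/-- A solution in `𝒲` leaves `{V > 0}` both in the past and in the future. -/
theorem exists_excursion (hsys : IsSystem Ω f) (hVW : IsVWPair Ω f V W)
    (hA : ConditionA Ω f V W wLow wUp cLow cUp 𝒲) (hB : ConditionB f V W 𝒲) {x : ℝ → Phase n}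
    (hx : IsSolutionOn Ω f x univ) (hx𝒲 : ∀ t, (t, x t) ∈ 𝒲) {t : ℝ} (ht : 0 < V (t, x t)) :
    ∃ a b, a < t ∧ t < b ∧ V (a, x a) = 0 ∧ V (b, x b) = 0 ∧
      ∀ s ∈ Ioo a b, 0 < V (s, x s) := by
  have hVc : Continuous fun s => V (s, x s) :=
    continuousOn_univ.1 (hx.continuousOn_comp hVW.continuous.continuousOn)
  have hW : ∀ s, W (s, x s) ∈ Ioo wLow wUp := fun s => (hA.subset (hx𝒲 s)).2
  obtain ⟨b, hb, hb0, hbpos⟩ : ∃ b, t < b ∧ V (b, x b) = 0 ∧ ∀ s ∈ Ico t b, 0 < V (s, x s) := by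
    -- If V stayed positive, the growth of W, at least the integral of α, would exceed w^* - w_*,
    -- the width of the range of W on 𝒲.
    obtain ⟨T, hTt, hT⟩ : ∃ T ≥ t, V (T, x T) ≤ 0 := by
      by_contra! hpos
      obtain ⟨T, hTt, hT⟩ := ((eventually_ge_atTop t).and
        ((tendsto_integral_alpha_atTop hsys hVW hA hB t).eventually_ge_atTop (wUp - wLow))).exists
      have := integral_alpha_le hsys hVW hA hTt (hx.mono (subset_univ _)) (fun s _ => hx𝒲 s)
        (fun s hs => hpos s hs.1.le)
      linarith [(hW t).1, (hW T).2]
    obtain ⟨b, hb, h0, hpos⟩ := exists_first_zero hTt hVc.continuousOn ht hT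
    exact ⟨b, hb.1, h0, hpos⟩
  obtain ⟨a, ha, ha0, hapos⟩ : ∃ a, a < t ∧ V (a, x a) = 0 ∧ ∀ s ∈ Ioc a t, 0 < V (s, x s) := by
    obtain ⟨T, hTt, hT⟩ : ∃ T ≤ t, V (T, x T) ≤ 0 := by
      by_contra! hpos
      obtain ⟨T, hTt, hT⟩ := ((eventually_le_atBot t).and
        ((tendsto_integral_alpha_atBot hsys hVW hA hB t).eventually_ge_atTop (wUp - wLow))).exists
      have := integral_alpha_le hsys hVW hA hTt (hx.mono (subset_univ _)) (fun s _ => hx𝒲 s)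
        (fun s hs => hpos s hs.2.le)
      linarith [(hW T).1, (hW t).2]
    obtain ⟨a, ha, h0, hpos⟩ := exists_last_zero hTt hVc.continuousOn hT ht
    exact ⟨a, ha.2, h0, hpos⟩
  refine ⟨a, b, ha, hb, ha0, hb0, fun s hs => ?_⟩
  rcases le_total s t with h | h
  · exact hapos s ⟨hs.1, h⟩
  · exact hbpos s ⟨h, hs.2⟩

theorem ConditionA.coeff_nonneg (hA : ConditionA Ω f V W wLow wUp cLow cUp 𝒲) :
    0 ≤ coeff cLow cUp := by
  have := hA.cUp_pos
  unfold coeff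
  split_ifs <;> positivity

/-- Integration from a gives V(t) ≤ c^*(W(t) - W(a)), and integration up to b gives V(t) ≤ c_*(W(b)
- W(t)). Weighting these by c_* and c^* eliminates W(t). For c_* = ∞ the first inequality and W(t) ≤
W(b) suffice. -/
theorem IsVWPair.apply_le_coeff_mul (hVW : IsVWPair Ω f V W) (hΩ : IsOpen Ω)
    (hA : ConditionA Ω f V W wLow wUp cLow cUp 𝒲) {x : ℝ → Phase n} {a b t : ℝ} (hat : a ≤ t)
    (htb : t ≤ b) (hx : IsSolutionOn Ω f x (Icc a b)) (hx𝒲 : ∀ s ∈ Ioo a b, (s, x s) ∈ 𝒲)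
    (hpos : ∀ s ∈ Ioo a b, 0 < V (s, x s)) (ha : V (a, x a) = 0) (hb : V (b, x b) = 0) :
    V (t, x t) ≤ coeff cLow cUp * (W (b, x b) - W (a, x a)) := by
  have hab := hat.trans htb
  have h1 := hVW.antitoneOn hΩ hA hx hx𝒲 hpos (left_mem_Icc.2 hab) ⟨hat, htb⟩ hat
  have hW := (hVW.strictMonoOn hΩ hx hpos).monotoneOn ⟨hat, htb⟩ (right_mem_Icc.2 hab) htb
  simp only [ha] at h1 hW
  have hc := hA.cUp_pos
  unfold coeff
  split_ifs with htop
  · have := mul_le_mul_of_nonneg_left hW hc.le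
    linarith
  · have h2 := hVW.monotoneOn hΩ hA htop hx hx𝒲 hpos ⟨hat, htb⟩ (right_mem_Icc.2 hab) htb
    simp only [hb] at h2
    have hl : 0 ≤ cLow.toReal := ENNReal.toReal_nonneg
    rw [div_mul_eq_mul_div, le_div_iff₀ (by positivity)]
    nlinarith [mul_le_mul_of_nonneg_left h1 hl, mul_le_mul_of_nonneg_left h2 hc.le]

/-- A real number strictly above ν is needed for the liminf to yield arbitrarily early starting
times; the slack below C leaves room for one, even when ν = -∞. -/
theorem exists_lt_of_lt_sub {ν : EReal} {A B C : ℝ} (hν : ν < ⊤)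
    (h : ((A : ℝ) : EReal) + max ν ((B : ℝ) : EReal) < ((C : ℝ) : EReal)) :
    ∃ r : ℝ, ν < r ∧ B ≤ r ∧ A + r < C := by
  obtain ⟨m, hm⟩ : ∃ m : ℝ, max ν (B : EReal) = m := by
    refine ⟨(max ν (B : EReal)).toReal, (EReal.coe_toReal ?_ ?_).symm⟩
    · exact (max_lt hν (EReal.coe_lt_top B)).ne
    · exact (lt_of_lt_of_le (EReal.bot_lt_coe B) (le_max_right _ _)).ne'
  rw [hm] at h
  have h' : A + m < C := by exact_mod_cast h
  have hB : B ≤ m := by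
    have : (B : EReal) ≤ m := hm ▸ le_max_right _ _
    exact_mod_cast this
  have hνm : ν ≤ m := hm ▸ le_max_left _ _
  refine ⟨(m + (C - A)) / 2, lt_of_le_of_lt hνm ?_, by linarith, by linarith⟩
  have : m < (m + (C - A)) / 2 := by linarith
  exact_mod_cast this

theorem exists_bounded_solution (hsys : IsSystem Ω f) (hVW : IsVWPair Ω f V W)
    (hA : ConditionA Ω f V W wLow wUp cLow cUp 𝒲) {M : ℝ → Set (Phase n)}
    (hC : ConditionC 𝒲 (exitSet Ω W wUp 𝒲) M ∨ ConditionC' 𝒲 (exitSet Ω W wUp 𝒲) M)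
    (hν : nu V W cUp M < ⊤) {Vs : ℝ}
    (hVs : ((cUp * wUp : ℝ) : EReal) +
      max (nu V W cUp M) ((-(cUp * omegaMin V W) : ℝ) : EReal) < (Vs : EReal))
    (hcls : closure ({p | V p ∈ Ico 0 Vs} ∩ 𝒲) ⊆ Ω) :
    ∃ (x : ℝ → Phase n) (K : ℝ), IsSolutionOn Ω f x univ ∧
      ∀ t, (t, x t) ∈ 𝒲 ∧ V (t, x t) ≤ K := by
  obtain ⟨r, hνr, hr, hrV⟩ := exists_lt_of_lt_sub hν hVs
  have hcl := closure_inter_sublevel_subset hVW.continuous hA hcls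
  have hC' : ∀ᶠ t in atBot, IsAdmissible 𝒲 (exitSet Ω W wUp 𝒲) t (M t) ∧
      ((IsRetractOf (exitPart (exitSet Ω W wUp 𝒲) t (M t)) {p ∈ exitSet Ω W wUp 𝒲 | t ≤ p.1} ∧
        ¬ IsRetractOf (exitPart (exitSet Ω W wUp 𝒲) t (M t)) ({t} ×ˢ M t)) ∨
      ¬ ∃ g : M t → ℝ × Phase n, IsEmbedding g ∧ (∀ x, g x ∈ exitSet Ω W wUp 𝒲) ∧
        ∀ x : M t, (t, (x : Phase n)) ∈ exitSet Ω W wUp 𝒲 → g x = (t, (x : Phase n))) := by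
    rcases hC with h | h
    · filter_upwards [h] with t ht using ⟨ht.1, Or.inl ht.2⟩
    · filter_upwards [h] with t ht using ⟨ht.1, Or.inr ht.2⟩
  have hfreq := frequently_lt_of_liminf_lt (by isBoundedDefault) hνr
  obtain ⟨x, hx, hx𝒲⟩ := exists_global_solution hsys hVW hA hcl hrV fun k => by
    obtain ⟨t₀, ht, ⟨hadm, hret⟩, htk⟩ :=
      (hfreq.and_eventually (hC'.and (eventually_le_atBot (-(k : ℝ))))).exists
    have hk : (-(k : ℝ)) ≤ k := by linarith [Nat.cast_nonneg (α := ℝ) k]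
    obtain ⟨x, hx, hx𝒲⟩ := exists_staying_solution hsys hVW hA hcl hr hrV (htk.trans hk) hadm.2
      (fun z hz hzV => by
        have : ((V (t₀, z) - cUp * W (t₀, z) : ℝ) : EReal) ≤ r :=
          (le_iSup₂ (f := fun (x : Phase n) (_ : x ∈ {x | x ∈ M t₀ ∧ 0 < V (t₀, x)}) =>
            ((V (t₀, x) - cUp * W (t₀, x) : ℝ) : EReal)) z ⟨hz, hzV⟩).trans ht.le
        exact_mod_cast this) hret
    exact ⟨x, hx.mono (Icc_subset_Icc_left htk), fun t ht => hx𝒲 t ⟨htk.trans ht.1, ht.2⟩⟩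
  exact ⟨x, _, hx, hx𝒲⟩

/-- The excursion around `t` takes place between any roots `τ₋` and `τ₊`. -/
theorem excursion_subset (hsys : IsSystem Ω f) (hVW : IsVWPair Ω f V W)
    (hA : ConditionA Ω f V W wLow wUp cLow cUp 𝒲) {x : ℝ → Phase n} {a b t τp τm : ℝ}
    (hat : a < t) (htb : t < b) (hx : IsSolutionOn Ω f x (Icc a b))
    (hx𝒲 : ∀ s ∈ Ioo a b, (s, x s) ∈ 𝒲) (hpos : ∀ s ∈ Ioo a b, 0 < V (s, x s))
    (ha : V (a, x a) = 0) (hb : V (b, x b) = 0) (hτp : IsTauPlus f V W 𝒲 t τp)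
    (hτm : IsTauMinus f V W 𝒲 t τm) : τm ≤ a ∧ b ≤ τp := by
  have hab := hat.trans htb
  have hV := hVW.regular.toIsSpatiallyCoercive
  have hint := intervalIntegrable_alpha hsys hVW hA
  have hWa := (hA.omegaMin_le hV a).trans (hA.wMin_le ha)
  have hWb := (hA.le_wMax hb).trans (hA.le_omegaMax hV b)
  have hmono := hVW.strictMonoOn hsys.isOpen hx hpos
  have h1 := hmono (left_mem_Icc.2 hab.le) ⟨hat.le, htb.le⟩ hat
  have h2 := hmono ⟨hat.le, htb.le⟩ (right_mem_Icc.2 hab.le) htb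
  have hat' := integral_alpha_le hsys hVW hA hat.le (hx.mono (Icc_subset_Icc_right htb.le))
    (fun s hs => hx𝒲 s ⟨hs.1, hs.2.trans htb⟩) (fun s hs => hpos s ⟨hs.1, hs.2.trans htb⟩)
  have htb' := integral_alpha_le hsys hVW hA htb.le (hx.mono (Icc_subset_Icc_left hat.le))
    (fun s hs => hx𝒲 s ⟨hat.trans hs.1, hs.2⟩) (fun s hs => hpos s ⟨hat.trans hs.1, hs.2⟩)
  simp only at h1 h2
  constructor
  -- If a < τ₋, nonnegativity of α makes its integral over [a,t] at least ω^0 - ω_0, whereas it is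
  -- at most W(t) - W(a) < W(b) - W(a) ≤ ω^0 - ω_0. Strict growth of W after t is why every root
  -- works, unique or not.
  · by_contra! h
    have hadd := intervalIntegral.integral_add_adjacent_intervals (hint a τm) (hint τm t)
    have := integral_alpha_nonneg hVW hA h.le
    rw [hτm.2] at hadd
    linarith
  · by_contra! h
    have hadd := intervalIntegral.integral_add_adjacent_intervals (hint t τp) (hint τp b)
    have := integral_alpha_nonneg hVW hA h.le
    rw [hτp.2] at hadd
    linarith

end VWPair

theorem mainTheorem1 {n : ℕ} (Ω : Set (ℝ × VWPair.Phase n))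
    (f : ℝ × VWPair.Phase n → VWPair.Phase n) (hsys : VWPair.IsSystem Ω f)
    (V W : ℝ × VWPair.Phase n → ℝ) (hVW : VWPair.IsVWPair Ω f V W)
    (wLow wUp : ℝ) (cLow : ℝ≥0∞) (cUp : ℝ) (𝒲 : Set (ℝ × VWPair.Phase n))
    (hA : VWPair.ConditionA Ω f V W wLow wUp cLow cUp 𝒲)
    (hB : VWPair.ConditionB f V W 𝒲)
    (M : ℝ → Set (VWPair.Phase n))
    (hC : VWPair.ConditionC 𝒲 (VWPair.exitSet Ω W wUp 𝒲) M ∨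
      VWPair.ConditionC' 𝒲 (VWPair.exitSet Ω W wUp 𝒲) M)
    (hν : VWPair.nu V W cUp M < ⊤)
    (Vs : ℝ)
    (hVs : ((cUp * wUp : ℝ) : EReal) +
      max (VWPair.nu V W cUp M) ((-(cUp * VWPair.omegaMin V W) : ℝ) : EReal) < (Vs : EReal))
    (hcls : closure ({p | V p ∈ Ico 0 Vs} ∩ 𝒲) ⊆ Ω) :
    ∃ x : ℝ → VWPair.Phase n, VWPair.IsGlobalVBoundedSolution Ω f V x ∧
      (∀ t : ℝ,
        (∃ τp, VWPair.IsTauPlus f V W 𝒲 t τp) ∧ (∃ τm, VWPair.IsTauMinus f V W 𝒲 t τm) ∧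
        ∀ τp τm : ℝ, VWPair.IsTauPlus f V W 𝒲 t τp → VWPair.IsTauMinus f V W 𝒲 t τm →
          V (t, x t) ≤ VWPair.coeff cLow cUp *
            (sSup (VWPair.wMax V W '' Icc t τp) - sInf (VWPair.wMin V W '' Icc τm t)) ∧
          VWPair.coeff cLow cUp *
            (sSup (VWPair.wMax V W '' Icc t τp) - sInf (VWPair.wMin V W '' Icc τm t)) ≤
            VWPair.coeff cLow cUp * (VWPair.omegaMax V W - VWPair.omegaMin V W)) ∧
      (∀ t : ℝ, 0 ≤ V (t, x t) →
        W (t, x t) ∈ Icc (VWPair.omegaMin V W) (VWPair.omegaMax V W)) ∧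
      ((∀ p, V p ≤ 0 → W p ∈ Icc (VWPair.omegaMin V W) (VWPair.omegaMax V W)) →
        ∀ t : ℝ, W (t, x t) ∈ Icc (VWPair.omegaMin V W) (VWPair.omegaMax V W)) := by
  have hV := hVW.regular.toIsSpatiallyCoercive
  obtain ⟨x, K, hx, hxK⟩ := VWPair.exists_bounded_solution hsys hVW hA hC hν hVs hcls
  have hexc := fun t => VWPair.exists_excursion hsys hVW hA hB hx (fun t => (hxK t).1) (t := t)
  have hsub : ∀ a b : ℝ, VWPair.IsSolutionOn Ω f x (Icc a b) := fun a b => hx.mono (subset_univ _)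
  have hWV : ∀ t : ℝ, 0 ≤ V (t, x t) →
      W (t, x t) ∈ Icc (VWPair.omegaMin V W) (VWPair.omegaMax V W) := by
    intro t ht
    have hzero : ∀ s, V (s, x s) = 0 →
        W (s, x s) ∈ Icc (VWPair.omegaMin V W) (VWPair.omegaMax V W) := fun s hs =>
      ⟨(hA.omegaMin_le hV s).trans (hA.wMin_le hs), (hA.le_wMax hs).trans (hA.le_omegaMax hV s)⟩
    rcases ht.eq_or_lt with h | h
    · exact hzero t h.symm
    · obtain ⟨a, b, hat, htb, ha, hb, hpos⟩ := hexc t h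
      have hmono := (hVW.strictMonoOn hsys.isOpen (hsub a b) hpos).monotoneOn
      have hab := hat.trans htb
      exact ⟨(hzero a ha).1.trans (hmono (left_mem_Icc.2 hab.le) ⟨hat.le, htb.le⟩ hat.le),
        (hmono ⟨hat.le, htb.le⟩ (right_mem_Icc.2 hab.le) htb.le).trans (hzero b hb).2⟩
  refine ⟨x, ⟨hx, ⟨K, ?_⟩⟩, fun t => ⟨VWPair.exists_isTauPlus hsys hVW hA hB t,
    VWPair.exists_isTauMinus hsys hVW hA hB t, fun τp τm hτp hτm => ?_⟩, hWV, fun hω t => ?_⟩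
  · rintro _ ⟨t, rfl⟩
    exact (hxK t).2
  · have hbddMax : BddAbove (VWPair.wMax V W '' Icc t τp) :=
      ⟨wUp, by rintro _ ⟨s, -, rfl⟩; exact hA.wMax_le hV s⟩
    have hbddMin : BddBelow (VWPair.wMin V W '' Icc τm t) :=
      ⟨wLow, by rintro _ ⟨s, -, rfl⟩; exact hA.le_wMin hV s⟩
    have hle : ∀ s ∈ Icc t τp, VWPair.wMax V W s ≤ sSup (VWPair.wMax V W '' Icc t τp) :=
      fun s hs => le_csSup hbddMax (mem_image_of_mem _ hs)
    have hge : ∀ s ∈ Icc τm t, sInf (VWPair.wMin V W '' Icc τm t) ≤ VWPair.wMin V W s :=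
      fun s hs => csInf_le hbddMin (mem_image_of_mem _ hs)
    constructor
    · rcases le_or_gt (V (t, x t)) 0 with h | h
      -- Both time intervals contain t, so the bracket is at least w^0(t) - w_0(t) ≥ 0.
      · refine h.trans (mul_nonneg hA.coeff_nonneg (sub_nonneg.2 ?_))
        exact (hge t ⟨hτm.1, le_rfl⟩).trans
          ((hA.wMin_le_wMax hV t).trans (hle t ⟨le_rfl, hτp.1⟩))
      · obtain ⟨a, b, hat, htb, ha, hb, hpos⟩ := hexc t h
        obtain ⟨hma, hbp⟩ := VWPair.excursion_subset hsys hVW hA hat htb (hsub a b)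
          (fun s _ => (hxK s).1) hpos ha hb hτp hτm
        refine (hVW.apply_le_coeff_mul hsys.isOpen hA hat.le htb.le (hsub a b)
          (fun s _ => (hxK s).1) hpos ha hb).trans
          (mul_le_mul_of_nonneg_left (sub_le_sub ?_ ?_) hA.coeff_nonneg)
        · exact (hA.le_wMax hb).trans (hle b ⟨htb.le, hbp⟩)
        · exact (hge a ⟨hma, hat.le⟩).trans (hA.wMin_le ha)
    · refine mul_le_mul_of_nonneg_left (sub_le_sub ?_ ?_) hA.coeff_nonneg
      · exact csSup_le ((nonempty_Icc.2 hτp.1).image _)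
          (by rintro _ ⟨s, -, rfl⟩; exact hA.le_omegaMax hV s)
      · exact le_csInf ((nonempty_Icc.2 hτm.1).image _)
          (by rintro _ ⟨s, -, rfl⟩; exact hA.omegaMin_le hV s)
  · rcases le_total 0 (V (t, x t)) with h | h
    · exact hWV t h
    · exact hω _ h
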